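/- Let $n\ge 1$ and let $T\subset\mathbb R^n$ be an $n$-simplex with vertices $a_1,\dots,a_{n+1}$, barycentric coordinates $\lambda_1,\dots,\lambda_{n+1}$ and bubble function $q_T=\lambda_1\lambda_2\cdots\lambda_{n+1}$. Let $$P_T^{(n+1,n)}:=\mathcal P_{n+1}(T)+q_T\,\mathcal P_1(T),$$ where $\mathcal P_k(T)$ is the space of polynomials on $T$ of total degree at most $k$. For $1\le k\le n$ and every $(n-k)$-dimensional sub-simplex $F$ of $T$, let $|F|$ be its $(n-k)$-dimensional measure ($|F|=1$ if $F$ is a vertex), and let $\nu_{F,1},\dots,\nu_{F,k}$ be any linearly independent unit vectors orthogonal to the tangent space of $F$. Let $D_T^{(n+1,n)}$ consist of the functionals $$d_{T,F,\alpha}(v)=\frac1{|F|}\int_F\frac{\partial^{\,n+1-k}v}{\partial\nu_{F,1}^{\alpha_1}\cdots\partial\nu_{F,k}^{\alpha_k}}$$ for all $1\le k\le n$, all $(n-k)$-dimensional sub-simplices $F$ of $T$ and all $(\alpha_1,\dots,\alpha_k)\in\mathbb Z_{\ge0}^k$ with $\alpha_1+\cdots+\alpha_k=n+1-k$ (integration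 over a vertex being evaluation), together with the vertex values $d_{T,a_i,0}(v)=v(a_i)$, $1\le i\le n+1$. Then the dimension of $P_T^{(n+1,n)}$ and the number of degrees of freedom in $D_T^{(n+1,n)}$ are both equal to $\binom{2n+1}{n}+n$, and $D_T^{(n+1,n)}$ is $P_T^{(n+1,n)}$-unisolvent: its members are linear functionals on $P_T^{(n+1,n)}$, and for every choice of real values, one for each degree of freedom, there is exactly one $p\in P_T^{(n+1,n)}$ at which the degrees of freedom take these values. -/

import Mathlib

open MeasureTheory

namespace NonconformingFE

/-- An `n`-simplex in `ℝⁿ`: `n + 1` affinely independent vertices. -/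
abbrev NSimplex (n : ℕ) := Affine.Simplex ℝ (EuclideanSpace ℝ (Fin n)) n

/-- The vertices of an `n`-simplex in `ℝⁿ`, as an affine basis of `ℝⁿ`. -/
noncomputable def vertexBasis {n : ℕ} (T : NSimplex n) :
    AffineBasis (Fin (n + 1)) ℝ (EuclideanSpace ℝ (Fin n)) where
  toFun := T.points
  ind' := T.independent
  tot' := T.independent.affineSpan_eq_top_iff_card_eq_finrank_add_one.2 (by simp)

/-- The linear map sending a polynomial in `n` variables to its polynomial function on `ℝⁿ`. -/
noncomputable def polyFun (n : ℕ) :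
    MvPolynomial (Fin n) ℝ →ₗ[ℝ] (EuclideanSpace ℝ (Fin n) → ℝ) where
  toFun p := fun x => MvPolynomial.eval (fun i => x i) p
  map_add' p q := by ext x; simp
  map_smul' c p := by ext x; simp [MvPolynomial.smul_eval]

/-- `𝒫_d`: polynomial functions of total degree at most `d`. -/
noncomputable def polySpace (n d : ℕ) : Submodule ℝ (EuclideanSpace ℝ (Fin n) → ℝ) :=
  (MvPolynomial.restrictTotalDegree (Fin n) ℝ d).map (polyFun n)

/-- The volume bubble function `q_T`, the product of all barycentric coordinates of `T`. -/
noncomputable def bubble {n : ℕ} (T : NSimplex n) : EuclideanSpace ℝ (Fin n) → ℝ :=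
  fun x => ∏ i, (vertexBasis T).coord i x

/-- The shape function space `𝒫_{n+1} + q_T 𝒫_1`. -/
noncomputable def shapeSpace {n : ℕ} (T : NSimplex n) :
    Submodule ℝ (EuclideanSpace ℝ (Fin n) → ℝ) :=
  polySpace n (n + 1) ⊔
    (polySpace n 1).map (LinearMap.mulLeft ℝ (bubble T))

/-- The `(n-k)`-dimensional sub-simplices of an `n`-simplex, each given by its set of
`n + 1 - k` vertices. -/
abbrev FaceOfCodim (n k : ℕ) := {F : Finset (Fin (n + 1)) // F.card = n + 1 - k}

/-- Multi-indices `(α₁, …, α_k)` with `|α| = n + 1 - k`. -/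
abbrev NormalMultiIndex (n k : ℕ) := {α : Fin k → ℕ // ∑ j, α j = n + 1 - k}

/-- The vertex set in `ℝⁿ` of the sub-simplex `F` of `T`. -/
def faceVertices {n : ℕ} (T : NSimplex n) {k : ℕ} (F : FaceOfCodim n k) :
    Set (EuclideanSpace ℝ (Fin n)) :=
  T.points '' (F.1 : Set (Fin (n + 1)))

/-- `ν` selects, for every sub-simplex `F` of codimension `1 ≤ k ≤ n`, linearly independent
unit vectors `ν_{F,1}, …, ν_{F,k}` orthogonal to the tangent space of `F`. -/
structure IsNormalFrame {n : ℕ} (T : NSimplex n)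
    (ν : (k : ℕ) → FaceOfCodim n k → Fin k → EuclideanSpace ℝ (Fin n)) : Prop where
  norm_eq_one : ∀ k, 1 ≤ k → k ≤ n → ∀ F j, ‖ν k F j‖ = 1
  orthogonal : ∀ k, 1 ≤ k → k ≤ n → ∀ F j, ν k F j ∈ (vectorSpan ℝ (faceVertices T F))ᗮ
  linearIndependent : ∀ k, 1 ≤ k → k ≤ n → ∀ F, LinearIndependent ℝ (ν k F)

/-- The first order directional derivative `∂v/∂e`. -/
noncomputable def dirDeriv {n : ℕ} (e : EuclideanSpace ℝ (Fin n))
    (v : EuclideanSpace ℝ (Fin n) → ℝ) : EuclideanSpace ℝ (Fin n) → ℝ :=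
  fun x => lineDeriv ℝ v x e

/-- The iterated directional derivative `∂^{|α|} v / (∂e₁^{α₁} ⋯ ∂e_k^{α_k})`. -/
noncomputable def iterDirDeriv {n k : ℕ} (e : Fin k → EuclideanSpace ℝ (Fin n))
    (α : Fin k → ℕ) (v : EuclideanSpace ℝ (Fin n) → ℝ) : EuclideanSpace ℝ (Fin n) → ℝ :=
  (List.finRange k).foldr (fun j w => (dirDeriv (e j))^[α j] w) v

/-- The average `|F|⁻¹ ∫_F f` over the sub-simplex `F` of codimension `k`, with respect to the
`(n-k)`-dimensional Euclidean measure (the counting measure when `F` is a vertex). -/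
noncomputable def faceAverage {n : ℕ} (T : NSimplex n) {k : ℕ} (F : FaceOfCodim n k)
    (f : EuclideanSpace ℝ (Fin n) → ℝ) : ℝ :=
  ⨍ x in convexHull ℝ (faceVertices T F), f x ∂μHE[n - k]

/-- Labels of the degrees of freedom: triples `(k, F, α)` with `1 ≤ k ≤ n`, `F` a sub-simplex of
codimension `k` and `|α| = n + 1 - k`, together with the `n + 1` vertices. -/
abbrev DOFIndex (n : ℕ) :=
  (Σ k : {k : ℕ // 1 ≤ k ∧ k ≤ n}, FaceOfCodim n k.1 × NormalMultiIndex n k.1) ⊕ Fin (n + 1)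

/-- The degrees of freedom: averages over `F` of the normal derivatives of order `n + 1 - k`,
and the vertex values. -/
noncomputable def dof {n : ℕ} (T : NSimplex n)
    (ν : (k : ℕ) → FaceOfCodim n k → Fin k → EuclideanSpace ℝ (Fin n)) :
    DOFIndex n → (EuclideanSpace ℝ (Fin n) → ℝ) → ℝ
  | Sum.inl ⟨k, F, α⟩, v => faceAverage T F (iterDirDeriv (ν k.1 F) α.1 v)
  | Sum.inr i, v => v (T.points i)

/-- A family `d` of functionals is `P`-unisolvent: the `d i` are linear functionals on `P`, and
for arbitrary prescribed real values there is exactly one `p ∈ P` attaining them. -/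
def Unisolvent {X ι : Type*} (P : Submodule ℝ (X → ℝ)) (d : ι → (X → ℝ) → ℝ) : Prop :=
  (∀ i, IsLinearMap ℝ (fun p : P => d i (p : X → ℝ))) ∧
    ∀ c : ι → ℝ, ∃! p : P, ∀ i, d i (p : X → ℝ) = c i

end NonconformingFE

/-! The dimension of the shape space equals the number of functionals, so unisolvence reduces to
this: a shape function v = p + q_T l on which all degrees of freedom vanish is zero.

Stokes' theorem turns the integral over an m-face of a derivative containing an edge direction of
that face into a difference of integrals over two of its facets, of a derivative of one order less.
Edge directions and normals of a proper face together span ℝⁿ, and purely normal derivatives are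
degrees of freedom; on T itself the edges alone span. Induction on m gives
`faceAveragesVanish_of_dof`: every derivative of order m+1 has zero average over every m-face. If
deg v ≤ n+1, a descent finishes: once all derivatives of order r+1 vanish, those of order r are
constants with zero average, hence zero; after r = 1 only a constant remains, and a vertex value
kills it (`eq_zero_of_faceAveragesVanish`).

The difficulty is the part of degree n+2, that is, showing that l is constant. Fix an edge e₀ from a
vertex a, and let e_j be the remaining edges out of a. Since ∂₀l is a constant α, ∂₀³(q_T l) is -6α
times the product of the barycentric coordinates of the vertices off e₀. This product does not vary
along e₀ and is affine in each e_j, so ∂_J∂₀³v vanishes at top order whenever J contains e₀ or a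
repetition, and by descent at every lower order (`edgeDeriv_eq_zero_of_isDegenerate`). In particular
∂₀³v is constant on the edge; equal end values and vanishing end gradients make this constant zero.
Adding the directions e_j one at a time, ∂_J∂₀³v is linear in a single coordinate of the next larger
face, and its zero average kills the slope (`edgeDeriv_nondegenerate_eq_zero`). When J exhausts all
e_j the derivative is -6α, so α = 0. As the edge was arbitrary, l is constant and deg v ≤ n+1.

The same argument with v = 0 shows that p + q_T l = 0 forces l to be constant, which gives the
dimension of the shape space. -/

namespace NonconformingFE

open MvPolynomial

variable {n N : ℕ}

/-! ### Formal directional derivatives of polynomials -/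

/-- The derivation of the polynomial ring given by the derivative in the direction `e`. -/
noncomputable def polyDeriv (n : ℕ) : EuclideanSpace ℝ (Fin n) →ₗ[ℝ]
    Derivation ℝ (MvPolynomial (Fin n) ℝ) (MvPolynomial (Fin n) ℝ) where
  toFun e := mkDerivation ℝ (fun i => C (e i))
  map_add' e f := by
    refine derivation_ext fun i => ?_
    simp [mkDerivation_X]
  map_smul' c e := by
    refine derivation_ext fun i => ?_
    simp [mkDerivation_X, smul_eq_C_mul]

@[simp]
lemma polyDeriv_X (e : EuclideanSpace ℝ (Fin n)) (i : Fin n) :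
    polyDeriv n e (X i) = C (e i) := mkDerivation_X _ _ _

@[simp]
lemma polyDeriv_C (e : EuclideanSpace ℝ (Fin n)) (c : ℝ) :
    polyDeriv n e (C c) = 0 := derivation_C _ _

lemma polyDeriv_comm (e f : EuclideanSpace ℝ (Fin n)) (p : MvPolynomial (Fin n) ℝ) :
    polyDeriv n e (polyDeriv n f p) = polyDeriv n f (polyDeriv n e p) := by
  have h : ⁅polyDeriv n e, polyDeriv n f⁆ = 0 := by
    refine derivation_ext fun i => ?_
    simp [Derivation.commutator_apply]
  have := congrArg (fun D => D p) h
  simpa [Derivation.commutator_apply, sub_eq_zero] using this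

lemma polyFun_apply (p : MvPolynomial (Fin n) ℝ) (x : EuclideanSpace ℝ (Fin n)) :
    polyFun n p x = eval (fun i => x i) p := rfl

lemma polyFun_mul (p q : MvPolynomial (Fin n) ℝ) :
    polyFun n (p * q) = polyFun n p * polyFun n q := by
  ext x; simp [polyFun_apply]

@[simp]
lemma polyFun_C (c : ℝ) (x : EuclideanSpace ℝ (Fin n)) : polyFun n (C c) x = c := by
  simp [polyFun_apply]

lemma polyFun_injective (n : ℕ) : Function.Injective (polyFun n) := by
  intro p q h
  refine MvPolynomial.funext fun x => ?_
  exact congrFun h (WithLp.toLp 2 x)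

lemma hasLineDerivAt_polyFun (p : MvPolynomial (Fin n) ℝ) (x e : EuclideanSpace ℝ (Fin n)) :
    HasLineDerivAt ℝ (polyFun n p) (polyFun n (polyDeriv n e p) x) x e := by
  unfold HasLineDerivAt
  induction p using MvPolynomial.induction_on with
  | C a => simpa [polyFun_apply] using hasDerivAt_const (0 : ℝ) a
  | add p q hp hq => simpa [polyFun_apply] using hp.fun_add hq
  | mul_X p i hp =>
    have hX : HasDerivAt (fun t : ℝ => polyFun n (X i) (x + t • e)) (e i) 0 := by
      have := ((hasDerivAt_id (0 : ℝ)).mul_const (e i)).const_add (x i)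
      simpa [polyFun_apply] using this
    have := hp.fun_mul hX
    rw [Derivation.leibniz]
    simp only [polyFun_mul, map_add, Pi.add_apply, smul_eq_mul, Pi.mul_apply,
      polyDeriv_X, polyFun_C]
    refine this.congr_deriv ?_
    simp only [zero_smul, add_zero]
    ring

lemma dirDeriv_polyFun (p : MvPolynomial (Fin n) ℝ) (e : EuclideanSpace ℝ (Fin n)) :
    dirDeriv e (polyFun n p) = polyFun n (polyDeriv n e p) := by
  ext x
  exact (hasLineDerivAt_polyFun p x e).lineDeriv

lemma hasDerivAt_polyFun_line (p : MvPolynomial (Fin n) ℝ) (x e : EuclideanSpace ℝ (Fin n))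
    (t : ℝ) : HasDerivAt (fun t : ℝ => polyFun n p (x + t • e))
      (polyFun n (polyDeriv n e p) (x + t • e)) t := by
  have h := hasLineDerivAt_polyFun p (x + t • e) e
  unfold HasLineDerivAt at h
  -- Writing the base point 0 as t - t lets the derivative at 0 be translated to t.
  rw [← sub_self t] at h
  have := HasDerivAt.comp_sub_const t t h
  refine this.congr_of_eventuallyEq (Filter.Eventually.of_forall fun s => ?_)
  simp [add_assoc, ← add_smul]

lemma continuous_polyFun (p : MvPolynomial (Fin n) ℝ) : Continuous (polyFun n p) := by
  have : Continuous fun x : EuclideanSpace ℝ (Fin n) => (fun i => x i : Fin n → ℝ) := by fun_prop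
  exact (MvPolynomial.continuous_eval p).comp this

/-- A polynomial whose derivative in direction `e` is constant along a line in that direction is
affine along this line. -/
lemma polyFun_line_of_deriv_const {p : MvPolynomial (Fin n) ℝ} {x e : EuclideanSpace ℝ (Fin n)}
    {c : ℝ} (h : ∀ t : ℝ, polyFun n (polyDeriv n e p) (x + t • e) = c) (t : ℝ) :
    polyFun n p (x + t • e) = polyFun n p x + c * t := by
  have hd : ∀ s : ℝ, HasDerivAt (fun s : ℝ => polyFun n p (x + s • e) - c * s) 0 s := by
    intro s
    have := (hasDerivAt_polyFun_line p x e s).fun_sub ((hasDerivAt_id s).const_mul c)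
    simpa [h s] using this
  have := is_const_of_deriv_eq_zero (fun s => (hd s).differentiableAt) (fun s => (hd s).deriv) t 0
  simp at this
  linarith

lemma polyFun_add_of_polyDeriv_eq_zero {p : MvPolynomial (Fin n) ℝ}
    {x e : EuclideanSpace ℝ (Fin n)} (h : polyDeriv n e p = 0) :
    polyFun n p (x + e) = polyFun n p x := by
  have := polyFun_line_of_deriv_const (p := p) (x := x) (e := e) (c := 0) (by simp [h]) 1
  simpa using this

lemma polyFun_eq_of_forall_polyDeriv_eq_zero {p : MvPolynomial (Fin n) ℝ}
    (h : ∀ e, polyDeriv n e p = 0) (x y : EuclideanSpace ℝ (Fin n)) :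
    polyFun n p x = polyFun n p y := by
  have := polyFun_add_of_polyDeriv_eq_zero (x := y) (h (x - y))
  simpa using this

lemma eq_C_of_forall_polyDeriv_eq_zero {p : MvPolynomial (Fin n) ℝ}
    (h : ∀ e, polyDeriv n e p = 0) (x : EuclideanSpace ℝ (Fin n)) :
    p = C (polyFun n p x) := by
  refine polyFun_injective n ?_
  ext y
  rw [polyFun_C]
  exact polyFun_eq_of_forall_polyDeriv_eq_zero h _ _

lemma totalDegree_polyDeriv_le {p : MvPolynomial (Fin n) ℝ} {d : ℕ} (hp : p.totalDegree ≤ d + 1)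
    (e : EuclideanSpace ℝ (Fin n)) : (polyDeriv n e p).totalDegree ≤ d := by
  rw [← mem_restrictTotalDegree] at hp ⊢
  unfold restrictTotalDegree at hp
  rw [restrictSupport_eq_span] at hp
  induction hp using Submodule.span_induction with
  | mem p hp =>
    obtain ⟨s, hs, rfl⟩ := hp
    have : polyDeriv n e (monomial s 1) =
        (1 : ℝ) • s.sum fun i k => monomial (s - Finsupp.single i 1) (k : ℝ) • C (e i) :=
      mkDerivation_monomial ℝ (fun i => C (e i)) s 1
    rw [this]
    refine Submodule.smul_mem _ _ (Submodule.sum_mem _ fun i hi => ?_)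
    rw [mem_restrictTotalDegree]
    simp only [smul_eq_mul]
    refine (totalDegree_mul _ _).trans ?_
    rw [totalDegree_C, add_zero]
    refine (totalDegree_monomial_le _ _).trans ?_
    have hs' : s.degree ≤ d + 1 := hs
    have h1 : s.degree = (s - Finsupp.single i 1).degree + 1 := by
      have : s = (s - Finsupp.single i 1) + Finsupp.single i 1 := by
        refine (tsub_add_cancel_of_le ?_).symm
        simpa using Nat.one_le_iff_ne_zero.2 (Finsupp.mem_support_iff.1 hi)
      conv_lhs => rw [this]
      simp
    change (s - Finsupp.single i 1).degree ≤ d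
    omega
  | zero => simp
  | add p q _ _ hp hq => simpa using Submodule.add_mem _ hp hq
  | smul c p _ hp => simpa using Submodule.smul_mem _ c hp

lemma polyDeriv_eq_zero_of_totalDegree {p : MvPolynomial (Fin n) ℝ} (hp : p.totalDegree = 0)
    (e : EuclideanSpace ℝ (Fin n)) : polyDeriv n e p = 0 := by
  rw [totalDegree_eq_zero_iff_eq_C.1 hp, polyDeriv_C]

/-- The iterated derivative of a polynomial in the directions of the list `L`. -/
noncomputable def derivList (L : List (EuclideanSpace ℝ (Fin n))) (p : MvPolynomial (Fin n) ℝ) :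
    MvPolynomial (Fin n) ℝ :=
  L.foldr (fun e q => polyDeriv n e q) p

@[simp]
lemma derivList_nil (p : MvPolynomial (Fin n) ℝ) : derivList [] p = p := rfl

@[simp]
lemma derivList_cons (e : EuclideanSpace ℝ (Fin n)) (L : List (EuclideanSpace ℝ (Fin n)))
    (p : MvPolynomial (Fin n) ℝ) :
    derivList (e :: L) p = polyDeriv n e (derivList L p) := rfl

lemma derivList_append (L M : List (EuclideanSpace ℝ (Fin n))) (p : MvPolynomial (Fin n) ℝ) :
    derivList (L ++ M) p = derivList L (derivList M p) := by
  simp [derivList]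

lemma derivList_perm {L M : List (EuclideanSpace ℝ (Fin n))} (h : L.Perm M)
    (p : MvPolynomial (Fin n) ℝ) : derivList L p = derivList M p := by
  have : LeftCommutative
      (fun (e : EuclideanSpace ℝ (Fin n)) (q : MvPolynomial (Fin n) ℝ) => polyDeriv n e q) :=
    ⟨fun e f q => polyDeriv_comm e f q⟩
  exact h.foldr_eq p

@[simp]
lemma derivList_add (L : List (EuclideanSpace ℝ (Fin n))) (p q : MvPolynomial (Fin n) ℝ) :
    derivList L (p + q) = derivList L p + derivList L q := by
  induction L with
  | nil => rfl
  | cons e L ih => simp [ih]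

@[simp]
lemma derivList_smul (L : List (EuclideanSpace ℝ (Fin n))) (c : ℝ) (p : MvPolynomial (Fin n) ℝ) :
    derivList L (c • p) = c • derivList L p := by
  induction L with
  | nil => rfl
  | cons e L ih => simp [ih]

@[simp]
lemma derivList_zero (L : List (EuclideanSpace ℝ (Fin n))) :
    derivList L (0 : MvPolynomial (Fin n) ℝ) = 0 := by
  simpa using derivList_smul L 0 0

lemma derivList_eq_zero_of_totalDegree_lt (L : List (EuclideanSpace ℝ (Fin n)))
    {p : MvPolynomial (Fin n) ℝ} (h : p.totalDegree < L.length) : derivList L p = 0 := by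
  suffices ∀ d, ∀ p : MvPolynomial (Fin n) ℝ, p.totalDegree ≤ d → ∀ L : List _, d < L.length →
      derivList L p = 0 from this _ p le_rfl L h
  intro d
  induction d with
  | zero =>
    intro p hp L hL
    obtain ⟨e, L, rfl⟩ := List.exists_cons_of_length_pos hL
    rw [derivList_perm (List.perm_append_singleton e L).symm, derivList_append]
    simp [polyDeriv_eq_zero_of_totalDegree (Nat.le_zero.1 hp)]
  | succ d ih =>
    intro p hp L hL
    obtain ⟨e, L, rfl⟩ := List.exists_cons_of_length_pos (l := L) (by omega)
    rw [derivList_perm (List.perm_append_singleton e L).symm, derivList_append]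
    exact ih _ (totalDegree_polyDeriv_le hp e) L (by simpa using hL)

/-! ### Integration over simplices and Stokes' theorem along an edge -/

/-- The corner simplex `{y | 0 ≤ y i, ∑ y i ≤ 1}` in `ℝᵐ`. -/
def cornerSimplex (m : ℕ) : Set (Fin m → ℝ) := {y | (∀ i, 0 ≤ y i) ∧ ∑ i, y i ≤ 1}

lemma isClosed_cornerSimplex (m : ℕ) : IsClosed (cornerSimplex m) := by
  have : cornerSimplex m = (⋂ i, {y : Fin m → ℝ | 0 ≤ y i}) ∩ {y | ∑ i, y i ≤ 1} := by
    ext y; simp [cornerSimplex]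
  rw [this]
  exact (isClosed_iInter fun i => isClosed_le (by fun_prop) (by fun_prop)).inter
    (isClosed_le (by fun_prop) (by fun_prop))

lemma isCompact_cornerSimplex (m : ℕ) : IsCompact (cornerSimplex m) := by
  refine (isCompact_Icc (a := (0 : Fin m → ℝ)) (b := 1)).of_isClosed_subset
    (isClosed_cornerSimplex m) fun y hy => ⟨hy.1, fun i => ?_⟩
  exact (Finset.single_le_sum (fun j _ => hy.1 j) (Finset.mem_univ i)).trans hy.2

lemma measurableSet_cornerSimplex (m : ℕ) : MeasurableSet (cornerSimplex m) :=
  (isClosed_cornerSimplex m).measurableSet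

lemma convex_cornerSimplex (m : ℕ) : Convex ℝ (cornerSimplex m) := by
  intro x hx y hy a c ha hc hac
  refine ⟨fun i => ?_, ?_⟩
  · have := hx.1 i
    have := hy.1 i
    simp only [Pi.add_apply, Pi.smul_apply, smul_eq_mul]
    positivity
  · simp only [Pi.add_apply, Pi.smul_apply, smul_eq_mul, Finset.sum_add_distrib, ← Finset.mul_sum]
    nlinarith [hx.2, hy.2]

/-- The interior of the corner simplex. -/
def openCornerSimplex (m : ℕ) : Set (Fin m → ℝ) := {y | (∀ i, 0 < y i) ∧ ∑ i, y i < 1}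

lemma openCornerSimplex_subset (m : ℕ) : openCornerSimplex m ⊆ cornerSimplex m :=
  fun _ hy => ⟨fun i => (hy.1 i).le, hy.2.le⟩

lemma volume_openCornerSimplex_pos (m : ℕ) : 0 < volume (openCornerSimplex m) := by
  have : openCornerSimplex m = (⋂ i, {y : Fin m → ℝ | 0 < y i}) ∩ {y | ∑ i, y i < 1} := by
    ext y; simp [openCornerSimplex]
  have ho : IsOpen (openCornerSimplex m) := by
    rw [this]
    exact (isOpen_iInter_of_finite fun i => isOpen_lt (by fun_prop) (by fun_prop)).inter
      (isOpen_lt (by fun_prop) (by fun_prop))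
  refine ho.measure_pos volume ⟨fun _ => 1 / (m + 1), fun i => by positivity, ?_⟩
  simp only [Finset.sum_const, Finset.card_univ, Fintype.card_fin, nsmul_eq_mul]
  rw [mul_one_div, div_lt_one (by positivity)]
  linarith

lemma volume_cornerSimplex_pos (m : ℕ) : 0 < volume (cornerSimplex m) :=
  (volume_openCornerSimplex_pos m).trans_le (measure_mono (openCornerSimplex_subset m))

lemma volume_cornerSimplex_lt_top (m : ℕ) : volume (cornerSimplex m) < ⊤ :=
  (isCompact_cornerSimplex m).measure_lt_top

lemma measureReal_cornerSimplex_pos (m : ℕ) : 0 < volume.real (cornerSimplex m) :=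
  ENNReal.toReal_pos (volume_cornerSimplex_pos m).ne' (volume_cornerSimplex_lt_top m).ne

lemma integral_coord_cornerSimplex_pos {m : ℕ} (i : Fin m) :
    0 < ∫ y in cornerSimplex m, y i := by
  rw [setIntegral_pos_iff_support_of_nonneg_ae]
  · refine (volume_openCornerSimplex_pos m).trans_le (measure_mono fun y hy => ⟨(hy.1 i).ne', ?_⟩)
    exact openCornerSimplex_subset m hy
  · exact ae_restrict_of_forall_mem (measurableSet_cornerSimplex m) fun y hy => hy.1 i
  · exact (continuous_apply i).continuousOn.integrableOn_compact (isCompact_cornerSimplex m)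

/-- The affine parametrization of the simplex with vertices `b` by the corner simplex. -/
noncomputable def simplexParam {m : ℕ} (b : Fin (m + 1) → EuclideanSpace ℝ (Fin n))
    (y : Fin m → ℝ) : EuclideanSpace ℝ (Fin n) :=
  b 0 + ∑ i, y i • (b i.succ - b 0)

lemma continuous_simplexParam {m : ℕ} (b : Fin (m + 1) → EuclideanSpace ℝ (Fin n)) :
    Continuous (simplexParam b) := by
  unfold simplexParam
  fun_prop

/-- The coordinate x slides a point of the facet opposite vertex 1 along the edge from vertex 0 to
vertex 1. At the far end x = 1 - ∑ z it reaches the facet opposite vertex 0, which is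
`simplexParam_succ`; these are the two boundary terms of Stokes' theorem. -/
lemma simplexParam_cons {m : ℕ} (b : Fin (m + 2) → EuclideanSpace ℝ (Fin n)) (x : ℝ)
    (z : Fin m → ℝ) : simplexParam b (Fin.cons x z) =
      simplexParam (b ∘ Fin.succAbove 1) z + x • (b 1 - b 0) := by
  simp only [simplexParam, Fin.sum_univ_succ, Fin.cons_zero, Fin.cons_succ, Function.comp_apply,
    Fin.succ_zero_eq_one]
  have h0 : (1 : Fin (m + 2)).succAbove 0 = 0 := by simp
  have h1 : ∀ i : Fin m, (1 : Fin (m + 2)).succAbove i.succ = i.succ.succ := fun i => by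
    rw [← Fin.succ_zero_eq_one, Fin.succ_succAbove_succ, Fin.succAbove_zero]
  simp only [h0, h1]
  abel

lemma simplexParam_succ {m : ℕ} (b : Fin (m + 2) → EuclideanSpace ℝ (Fin n))
    (z : Fin m → ℝ) : simplexParam (b ∘ Fin.succ) z =
      simplexParam (b ∘ Fin.succAbove 1) z + (1 - ∑ i, z i) • (b 1 - b 0) := by
  simp only [simplexParam, Function.comp_apply, Fin.succ_zero_eq_one]
  have h0 : (1 : Fin (m + 2)).succAbove 0 = 0 := by simp
  have h1 : ∀ i : Fin m, (1 : Fin (m + 2)).succAbove i.succ = i.succ.succ := fun i => by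
    rw [← Fin.succ_zero_eq_one, Fin.succ_succAbove_succ, Fin.succAbove_zero]
  simp only [h0, h1, smul_sub, sub_smul, Finset.sum_sub_distrib, ← Finset.sum_smul, one_smul]
  abel

lemma convexHull_range_eq_image_simplexParam {m : ℕ}
    (b : Fin (m + 1) → EuclideanSpace ℝ (Fin n)) :
    convexHull ℝ (Set.range b) = simplexParam b '' cornerSimplex m := by
  apply subset_antisymm
  · refine convexHull_min ?_ ?_
    · rintro _ ⟨i, rfl⟩
      induction i using Fin.cases with
      | zero => exact ⟨0, by simp [cornerSimplex], by simp [simplexParam]⟩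
      | succ i =>
        refine ⟨Pi.single i 1, ⟨fun j => ?_, by simp⟩, ?_⟩
        · by_cases h : j = i
          · subst h; simp
          · simp [h]
        · simp [simplexParam, Pi.single_apply, ite_smul]
    · rintro _ ⟨x, hx, rfl⟩ _ ⟨y, hy, rfl⟩ a c ha hc hac
      refine ⟨a • x + c • y, convex_cornerSimplex m hx hy ha hc hac, ?_⟩
      simp only [simplexParam, Pi.add_apply, Pi.smul_apply, smul_eq_mul, add_smul,
        Finset.sum_add_distrib, mul_smul, ← Finset.smul_sum, smul_add]
      have : b 0 = a • b 0 + c • b 0 := by rw [← add_smul, hac, one_smul]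
      nth_rewrite 1 [this]
      abel
  · rintro _ ⟨y, hy, rfl⟩
    have : simplexParam b y =
        ∑ i, (Fin.cons (1 - ∑ i, y i) y : Fin (m + 1) → ℝ) i • b i := by
      simp only [simplexParam, Fin.sum_univ_succ, Fin.cons_zero, Fin.cons_succ, smul_sub, sub_smul,
        Finset.sum_sub_distrib, ← Finset.sum_smul, one_smul]
      abel
    rw [this]
    refine (convex_convexHull ℝ _).sum_mem (fun i _ => ?_) ?_
      fun i _ => subset_convexHull ℝ _ (Set.mem_range_self i)
    · induction i using Fin.cases with
      | zero => simpa using hy.2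
      | succ i => simpa using hy.1 i
    · simp [Fin.sum_univ_succ]

/-- Fubini with coordinate 0 innermost, so that the fundamental theorem of calculus applies along
the edge belonging to that coordinate. -/
lemma setIntegral_cornerSimplex_succ {m : ℕ} {h : (Fin (m + 1) → ℝ) → ℝ} (hh : Continuous h) :
    ∫ y in cornerSimplex (m + 1), h y =
      ∫ z in cornerSimplex m, ∫ x in (0 : ℝ)..(1 - ∑ i, z i), h (Fin.cons x z) := by
  have hmp := (volume_preserving_piFinSuccAbove (fun _ : Fin (m + 1) => ℝ) 0).symm
  have hemb :=
    (MeasurableEquiv.piFinSuccAbove (fun _ : Fin (m + 1) => ℝ) 0).symm.measurableEmbedding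
  have hcons : ∀ p : ℝ × (Fin m → ℝ),
      (MeasurableEquiv.piFinSuccAbove (fun _ : Fin (m + 1) => ℝ) 0).symm p = Fin.cons p.1 p.2 := by
    intro p
    simp only [MeasurableEquiv.piFinSuccAbove, MeasurableEquiv.symm_mk, MeasurableEquiv.coe_mk,
      Equiv.symm_symm, Fin.insertNthEquiv_zero]
    rfl
  rw [← integral_indicator (measurableSet_cornerSimplex _), ← hmp.integral_comp hemb]
  have hint : Integrable ((cornerSimplex (m + 1)).indicator h) :=
    (hh.continuousOn.integrableOn_compact (isCompact_cornerSimplex _)).integrable_indicator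
      (measurableSet_cornerSimplex _)
  have hint' := (hmp.integrable_comp_emb hemb).2 hint
  have hvol : (volume : Measure (ℝ × (Fin m → ℝ))) = (volume : Measure ℝ).prod volume := rfl
  rw [hvol, integral_prod_symm
    (fun x => (cornerSimplex (m + 1)).indicator h
      ((MeasurableEquiv.piFinSuccAbove (fun _ : Fin (m + 1) => ℝ) 0).symm x)) hint',
    ← integral_indicator (measurableSet_cornerSimplex _)]
  congr 1
  ext z
  by_cases hz : z ∈ cornerSimplex m
  · rw [Set.indicator_of_mem hz, intervalIntegral.integral_of_le (by linarith [hz.2]),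
      ← integral_Icc_eq_integral_Ioc, ← integral_indicator measurableSet_Icc]
    congr 1
    ext x
    rw [hcons]
    have : (Fin.cons x z : Fin (m + 1) → ℝ) ∈ cornerSimplex (m + 1) ↔
        x ∈ Set.Icc 0 (1 - ∑ i, z i) := by
      simp only [cornerSimplex, Set.mem_ofPred_eq, Fin.forall_fin_succ, Fin.cons_zero, Fin.cons_succ,
        Fin.sum_univ_succ, Set.mem_Icc]
      constructor
      · rintro ⟨⟨h1, _⟩, h2⟩
        exact ⟨h1, by linarith⟩
      · rintro ⟨h1, h2⟩
        exact ⟨⟨h1, hz.1⟩, by linarith⟩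
    by_cases hx : x ∈ Set.Icc 0 (1 - ∑ i, z i)
    · rw [Set.indicator_of_mem hx, Set.indicator_of_mem (this.2 hx)]
    · rw [Set.indicator_of_notMem hx, Set.indicator_of_notMem (mt this.1 hx)]
  · rw [Set.indicator_of_notMem hz]
    refine integral_eq_zero_of_ae (Filter.Eventually.of_forall fun x => ?_)
    simp only [hcons]
    refine Set.indicator_of_notMem (fun hx => hz ⟨fun i => by simpa using hx.1 i.succ, ?_⟩) _
    have h1 := hx.1 0
    have h2 := hx.2
    simp only [Fin.sum_univ_succ, Fin.cons_zero, Fin.cons_succ] at h1 h2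
    linarith

/-- Stokes' theorem for the derivative of a polynomial along an edge of a simplex. -/
lemma setIntegral_polyDeriv_edge {m : ℕ} (b : Fin (m + 2) → EuclideanSpace ℝ (Fin n))
    (p : MvPolynomial (Fin n) ℝ) :
    ∫ y in cornerSimplex (m + 1), polyFun n (polyDeriv n (b 1 - b 0) p) (simplexParam b y) =
      (∫ z in cornerSimplex m, polyFun n p (simplexParam (b ∘ Fin.succ) z)) -
        ∫ z in cornerSimplex m, polyFun n p (simplexParam (b ∘ Fin.succAbove 1) z) := by
  have hcont : ∀ (k : ℕ) (c : Fin (k + 1) → EuclideanSpace ℝ (Fin n)) (q : MvPolynomial (Fin n) ℝ),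
      Continuous fun y => polyFun n q (simplexParam c y) := fun k c q =>
    (continuous_polyFun q).comp (continuous_simplexParam c)
  rw [setIntegral_cornerSimplex_succ (hcont _ _ _), ← integral_sub]
  · refine setIntegral_congr_fun (measurableSet_cornerSimplex m) fun z _ => ?_
    simp only [simplexParam_cons, simplexParam_succ]
    rw [intervalIntegral.integral_eq_sub_of_hasDerivAt
      (fun x _ => hasDerivAt_polyFun_line p _ (b 1 - b 0) x)]
    · simp
    · refine Continuous.intervalIntegrable ?_ _ _
      exact (continuous_polyFun _).comp (by fun_prop)
  · exact (hcont _ _ _).continuousOn.integrableOn_compact (isCompact_cornerSimplex m)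
  · exact (hcont _ _ _).continuousOn.integrableOn_compact (isCompact_cornerSimplex m)

/-- The average over a simplex with respect to the Euclidean Hausdorff measure is the average of
the pullback to the corner simplex. -/
lemma setAverage_convexHull_range {m : ℕ} {b : Fin (m + 1) → EuclideanSpace ℝ (Fin n)}
    (hb : AffineIndependent ℝ b) (f : EuclideanSpace ℝ (Fin n) → ℝ) :
    ⨍ x in convexHull ℝ (Set.range b), f x ∂μHE[m] =
      (volume.real (cornerSimplex m))⁻¹ * ∫ y in cornerSimplex m, f (simplexParam b y) := by
  have hli : LinearIndependent ℝ fun i : Fin m => b i.succ - b 0 := by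
    have := (affineIndependent_iff_linearIndependent_vsub ℝ b 0).1 hb
    exact this.comp (fun i : Fin m => ⟨i.succ, Fin.succ_ne_zero i⟩)
      fun i j h => Fin.succ_injective _ (congrArg Subtype.val h)
  let A : EuclideanSpace ℝ (Fin m) →ₗ[ℝ] EuclideanSpace ℝ (Fin n) :=
    (Fintype.linearCombination ℝ fun i : Fin m => b i.succ - b 0) ∘ₗ
      (WithLp.linearEquiv 2 ℝ (Fin m → ℝ)).toLinearMap
  have hA : ∀ y, A (WithLp.toLp 2 y) = ∑ i, y i • (b i.succ - b 0) := fun y => by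
    simp [A, Fintype.linearCombination_apply]
  have hAinj : Function.Injective A := by
    exact hli.fintypeLinearCombination_injective.comp
      (WithLp.linearEquiv 2 ℝ (Fin m → ℝ)).injective
  have hΦ : ∀ y, simplexParam b y = b 0 + A (WithLp.toLp 2 y) := fun y => by
    rw [hA]; rfl
  have hΦinj : Function.Injective (simplexParam b) := fun y z h => by
    rw [hΦ, hΦ] at h
    simpa using hAinj (add_left_cancel h)
  have hc : A.normDet ≠ 0 := by
    rw [Ne, LinearMap.normDet_eq_zero_iff_ker_ne_bot, not_not]
    exact LinearMap.ker_eq_bot.2 hAinj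
  have hmeas : ∀ s : Set (Fin m → ℝ),
      μHE[m] (simplexParam b '' s) = ENNReal.ofReal A.normDet * volume s := by
    intro s
    have h1 : simplexParam b '' s = (fun x => b 0 + x) '' (A '' (WithLp.toLp 2 '' s)) := by
      simp only [Set.image_image, hΦ]
    have h2 := A.euclideanHausdorffMeasure_image_eq_normDet_mul_volume (WithLp.toLp 2 '' s)
    rw [finrank_euclideanSpace_fin] at h2
    rw [h1, (isometry_add_left (b 0)).euclideanHausdorffMeasure_image, h2]
    congr 1
    have :=
      (EuclideanSpace.volume_preserving_symm_measurableEquiv_toLp (Fin m)).measure_preimage_equiv s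
    rw [← this]
    congr 1
    ext x
    simp only [Set.mem_image, Set.mem_preimage]
    constructor
    · rintro ⟨y, hy, rfl⟩; exact hy
    · intro hx; exact ⟨_, hx, rfl⟩
  have hemb : MeasurableEmbedding (simplexParam b) := by
    refine (continuous_simplexParam b).measurableEmbedding hΦinj
  have hmap : (μHE[m] : Measure (EuclideanSpace ℝ (Fin n))).restrict
      (simplexParam b '' cornerSimplex m) =
      ENNReal.ofReal A.normDet • (volume.restrict (cornerSimplex m)).map (simplexParam b) := by
    ext t ht
    rw [Measure.restrict_apply ht, Measure.smul_apply, Measure.map_apply hemb.measurable ht,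
      Measure.restrict_apply (hemb.measurable ht), smul_eq_mul, ← hmeas, Set.image_preimage_inter]
  have hpos : 0 < A.normDet := lt_of_le_of_ne A.normDet_nonneg hc.symm
  -- The Jacobian `A.normDet` occurs in both the integral and the measure of the face, and cancels
  -- in the average.
  rw [convexHull_range_eq_image_simplexParam, setAverage_eq, measureReal_def, hmeas, hmap,
    integral_smul_measure, hemb.integral_map, ENNReal.toReal_mul, ENNReal.toReal_ofReal hpos.le,
    ← measureReal_def, smul_eq_mul, smul_eq_mul]
  field_simp

lemma integrableOn_polyFun_simplexParam {m : ℕ} (b : Fin (m + 1) → EuclideanSpace ℝ (Fin n))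
    (p : MvPolynomial (Fin n) ℝ) :
    IntegrableOn (fun y => polyFun n p (simplexParam b y)) (cornerSimplex m) :=
  ((continuous_polyFun p).comp (continuous_simplexParam b)).continuousOn.integrableOn_compact
    (isCompact_cornerSimplex m)

/-- The integral of a polynomial over the simplex with vertices `b`, pulled back to the corner
simplex, as a linear functional. -/
noncomputable def simplexIntegral {m : ℕ} (b : Fin (m + 1) → EuclideanSpace ℝ (Fin n)) :
    MvPolynomial (Fin n) ℝ →ₗ[ℝ] ℝ where
  toFun p := ∫ y in cornerSimplex m, polyFun n p (simplexParam b y)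
  map_add' p q := by
    simp only [map_add, Pi.add_apply]
    exact integral_add (integrableOn_polyFun_simplexParam b p)
      (integrableOn_polyFun_simplexParam b q)
  map_smul' c p := by
    simp only [map_smul, Pi.smul_apply, RingHom.id_apply]
    exact integral_smul c _

lemma simplexIntegral_apply {m : ℕ} (b : Fin (m + 1) → EuclideanSpace ℝ (Fin n))
    (p : MvPolynomial (Fin n) ℝ) :
    simplexIntegral b p = ∫ y in cornerSimplex m, polyFun n p (simplexParam b y) := rfl

lemma simplexIntegral_C {m : ℕ} (b : Fin (m + 1) → EuclideanSpace ℝ (Fin n)) (c : ℝ) :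
    simplexIntegral b (C c) = volume.real (cornerSimplex m) * c := by
  simp [simplexIntegral_apply]

lemma simplexIntegral_zero_dim (b : Fin 1 → EuclideanSpace ℝ (Fin n))
    (p : MvPolynomial (Fin n) ℝ) :
    simplexIntegral b p = volume.real (cornerSimplex 0) * polyFun n p (b 0) := by
  simp [simplexIntegral_apply, simplexParam]

lemma setAverage_polyFun {m : ℕ} {b : Fin (m + 1) → EuclideanSpace ℝ (Fin n)}
    (hb : AffineIndependent ℝ b) (p : MvPolynomial (Fin n) ℝ) :
    ⨍ x in convexHull ℝ (Set.range b), polyFun n p x ∂μHE[m] =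
      (volume.real (cornerSimplex m))⁻¹ * simplexIntegral b p :=
  setAverage_convexHull_range hb _

/-- Up to the same factor both sides are the average over the convex hull, which ignores the order
of the vertices. Hence any edge may be moved to positions 0 and 1. -/
lemma simplexIntegral_eq_of_range_eq {m : ℕ} {b c : Fin (m + 1) → EuclideanSpace ℝ (Fin n)}
    (hb : AffineIndependent ℝ b) (hc : AffineIndependent ℝ c) (h : Set.range b = Set.range c) :
    simplexIntegral b = simplexIntegral c := by
  refine LinearMap.ext fun p => ?_
  have := setAverage_polyFun hb p
  rw [h, setAverage_polyFun hc p] at this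
  exact (mul_left_cancel₀ (inv_ne_zero (measureReal_cornerSimplex_pos m).ne') this).symm

lemma simplexIntegral_polyDeriv_edge {m : ℕ} (b : Fin (m + 2) → EuclideanSpace ℝ (Fin n))
    (p : MvPolynomial (Fin n) ℝ) :
    simplexIntegral b (polyDeriv n (b 1 - b 0) p) =
      simplexIntegral (b ∘ Fin.succ) p - simplexIntegral (b ∘ Fin.succAbove 1) p :=
  setIntegral_polyDeriv_edge b p

/-! ### From averages of normal derivatives to averages of all derivatives -/

lemma exists_perm_zero_one {m : ℕ} {i j : Fin (m + 2)} (h : i ≠ j) :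
    ∃ π : Equiv.Perm (Fin (m + 2)), π 0 = i ∧ π 1 = j := by
  have h0 : Equiv.swap 0 i 1 ≠ i := by
    have : Equiv.swap 0 i (1 : Fin (m + 2)) ≠ Equiv.swap 0 i 0 := fun h' => by
      simpa using (Equiv.swap 0 i).injective h'
    simpa using this
  refine ⟨(Equiv.swap 0 i).trans (Equiv.swap (Equiv.swap 0 i 1) j), ?_, ?_⟩
  · simp only [Equiv.trans_apply, Equiv.swap_apply_left]
    exact Equiv.swap_apply_of_ne_of_ne h0.symm h
  · simp

/-- Vanishing of a linear functional on all derivatives of order `r` of a polynomial needs to be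
checked only for directions in a spanning set. -/
lemma map_derivList_eq_zero_of_span {X : Set (EuclideanSpace ℝ (Fin n))}
    (hX : Submodule.span ℝ X = ⊤) (Φ : MvPolynomial (Fin n) ℝ →ₗ[ℝ] ℝ)
    (p : MvPolynomial (Fin n) ℝ) (r : ℕ)
    (h : ∀ L : List (EuclideanSpace ℝ (Fin n)), (∀ e ∈ L, e ∈ X) → L.length = r →
      Φ (derivList L p) = 0)
    (L : List (EuclideanSpace ℝ (Fin n))) (hL : L.length = r) : Φ (derivList L p) = 0 := by
  -- `M` collects the directions already taken from the spanning set and `L` those still to be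
  -- expanded by linearity; commuting derivatives let the head of `L` move over to `M`.
  suffices ∀ L M : List (EuclideanSpace ℝ (Fin n)), (∀ e ∈ M, e ∈ X) → (L ++ M).length = r →
      Φ (derivList (L ++ M) p) = 0 by
    simpa using this L [] (by simp) (by simpa using hL)
  intro L
  induction L with
  | nil => intro M hM hr; exact h M hM hr
  | cons e L ih =>
    intro M hM hr
    have he : e ∈ Submodule.span ℝ X := hX ▸ Submodule.mem_top
    rw [List.cons_append, derivList_cons]
    induction he using Submodule.span_induction with
    | mem e he =>
      have := ih (e :: M) (by simpa [he] using hM) (by simpa [add_assoc] using hr)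
      rwa [derivList_perm List.perm_middle] at this
    | zero => simp
    | add e f _ _ h1 h2 =>
      simp [h1 hr, h2 hr]
    | smul c e _ h1 => simp [h1 hr]

lemma iterate_dirDeriv_polyFun (e : EuclideanSpace ℝ (Fin n)) (a : ℕ)
    (p : MvPolynomial (Fin n) ℝ) :
    (dirDeriv e)^[a] (polyFun n p) = polyFun n (derivList (List.replicate a e) p) := by
  induction a with
  | zero => rfl
  | succ a ih => rw [Function.iterate_succ_apply', ih, dirDeriv_polyFun, List.replicate_succ,
      derivList_cons]

/-- The list of directions, with multiplicities `α`, of an iterated derivative. -/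
def expandDirections {X : Type*} {k : ℕ} (e : Fin k → X) (α : Fin k → ℕ) : List X :=
  (List.finRange k).flatMap fun j => List.replicate (α j) (e j)

lemma iterDirDeriv_polyFun {k : ℕ} (e : Fin k → EuclideanSpace ℝ (Fin n)) (α : Fin k → ℕ)
    (p : MvPolynomial (Fin n) ℝ) :
    iterDirDeriv e α (polyFun n p) = polyFun n (derivList (expandDirections e α) p) := by
  unfold iterDirDeriv expandDirections
  induction List.finRange k with
  | nil => rfl
  | cons j l ih =>
    rw [List.foldr_cons, ih, iterate_dirDeriv_polyFun, List.flatMap_cons, derivList_append]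

/-- Since derivatives commute, a word in the normals matters only through its multiplicities, which
form the multi-index of a degree of freedom. -/
lemma map_perm_expandDirections {X : Type*} {k : ℕ} (e : Fin k → X) (J : List (Fin k)) :
    (J.map e).Perm (expandDirections e fun j => J.count j) := by
  have h : J.Perm (expandDirections id fun j => J.count j) := by
    rw [List.perm_iff_count]
    intro a
    simp only [expandDirections, List.count_flatMap, Function.comp_def, List.count_replicate,
      id, beq_iff_eq]
    rw [← List.sum_toFinset _ (List.nodup_finRange k)]
    simp
  refine (h.map e).trans ?_
  simp [expandDirections, List.map_flatMap]

lemma sum_count_eq_length {k : ℕ} (J : List (Fin k)) : ∑ j, J.count j = J.length := by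
  simpa using (Multiset.sum_count_eq_card (s := Finset.univ) (m := (J : Multiset (Fin k)))
    (by simp))

lemma affineIndependent_points_comp (T : NSimplex n) {m : ℕ} {σ : Fin (m + 1) → Fin (n + 1)}
    (hσ : Function.Injective σ) : AffineIndependent ℝ (T.points ∘ σ) :=
  T.independent.comp_embedding ⟨σ, hσ⟩

/-- All derivatives of order `m + 1` of `p` have vanishing average over every `m`-dimensional
sub-simplex of `T`. -/
def FaceAveragesVanish (T : NSimplex n) (p : MvPolynomial (Fin n) ℝ) : Prop :=
  ∀ (m : ℕ) (σ : Fin (m + 1) → Fin (n + 1)), Function.Injective σ →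
    ∀ L : List (EuclideanSpace ℝ (Fin n)), L.length = m + 1 →
      simplexIntegral (T.points ∘ σ) (derivList L p) = 0

/-- The inductive step by Stokes: with the edge moved to positions 0 and 1, the integral becomes a
difference of two facet integrals to which the hypothesis applies. -/
lemma simplexIntegral_derivList_edge_eq_zero {T : NSimplex n} {m : ℕ}
    {p : MvPolynomial (Fin n) ℝ}
    (h : ∀ σ : Fin (m + 1) → Fin (n + 1), Function.Injective σ →
      ∀ L : List (EuclideanSpace ℝ (Fin n)), L.length = m + 1 →
        simplexIntegral (T.points ∘ σ) (derivList L p) = 0)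
    {σ : Fin (m + 2) → Fin (n + 1)} (hσ : Function.Injective σ) (i j : Fin (m + 2))
    (L : List (EuclideanSpace ℝ (Fin n))) (hL : L.length = m + 1) :
    simplexIntegral (T.points ∘ σ)
      (derivList ((T.points (σ j) - T.points (σ i)) :: L) p) = 0 := by
  by_cases hij : i = j
  · simp [hij]
  obtain ⟨π, rfl, rfl⟩ := exists_perm_zero_one hij
  have hσ' : Function.Injective (σ ∘ π) := hσ.comp π.injective
  rw [simplexIntegral_eq_of_range_eq (affineIndependent_points_comp T hσ)
    (affineIndependent_points_comp T hσ')
    (by rw [← Function.comp_assoc, π.surjective.range_comp]), derivList_cons]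
  have := simplexIntegral_polyDeriv_edge (T.points ∘ σ ∘ π) (derivList L p)
  simp only [Function.comp_apply] at this
  rw [this]
  have h1 := h ((σ ∘ π) ∘ Fin.succ) (hσ'.comp (Fin.succ_injective _)) L hL
  have h2 := h ((σ ∘ π) ∘ Fin.succAbove 1) (hσ'.comp Fin.succAbove_right_injective) L hL
  simp only [Function.comp_assoc] at h1 h2 ⊢
  rw [h1, h2, sub_zero]

/-- The sub-simplex of `T` with vertices enumerated by `σ`. -/
def imageFace {m k : ℕ} (σ : Fin (m + 1) → Fin (n + 1)) (hσ : Function.Injective σ)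
    (hm : m + 1 = n + 1 - k) : FaceOfCodim n k :=
  ⟨Finset.univ.image σ, by rw [Finset.card_image_of_injective _ hσ]; simpa using hm⟩

lemma faceVertices_imageFace (T : NSimplex n) {m k : ℕ} (σ : Fin (m + 1) → Fin (n + 1))
    (hσ : Function.Injective σ) (hm : m + 1 = n + 1 - k) :
    faceVertices T (imageFace σ hσ hm) = Set.range (T.points ∘ σ) := by
  simp [faceVertices, imageFace, Set.range_comp]

lemma faceAverage_imageFace (T : NSimplex n) {m k : ℕ} (σ : Fin (m + 1) → Fin (n + 1))
    (hσ : Function.Injective σ) (hm : m + 1 = n + 1 - k) (p : MvPolynomial (Fin n) ℝ) :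
    faceAverage T (imageFace σ hσ hm) (polyFun n p) =
      (volume.real (cornerSimplex m))⁻¹ * simplexIntegral (T.points ∘ σ) p := by
  have : n - k = m := by omega
  rw [faceAverage, faceVertices_imageFace, this,
    setAverage_polyFun (affineIndependent_points_comp T hσ)]

lemma exists_eq_imageFace {k : ℕ} (hk : k ≤ n) (F : FaceOfCodim n k) :
    ∃ (m : ℕ) (σ : Fin (m + 1) → Fin (n + 1)) (hσ : Function.Injective σ)
      (hm : m + 1 = n + 1 - k), F = imageFace σ hσ hm := by
  have hc : F.1.card = (n - k) + 1 := by rw [F.2]; omega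
  refine ⟨n - k, F.1.orderEmbOfFin hc, (F.1.orderEmbOfFin hc).injective, by omega, ?_⟩
  apply Subtype.ext
  simp [imageFace]

/-- The edge vectors of a sub-simplex and a normal frame of it span `ℝⁿ`. -/
lemma span_normals_union_edges {T : NSimplex n}
    {ν : (k : ℕ) → FaceOfCodim n k → Fin k → EuclideanSpace ℝ (Fin n)}
    (hν : IsNormalFrame T ν) {k : ℕ} (hk : 1 ≤ k) (hkn : k ≤ n) (F : FaceOfCodim n k) :
    Submodule.span ℝ (Set.range (ν k F) ∪ (faceVertices T F -ᵥ faceVertices T F)) = ⊤ := by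
  have hV : Submodule.span ℝ (faceVertices T F -ᵥ faceVertices T F) =
    vectorSpan ℝ (faceVertices T F) := rfl
  obtain ⟨m, σ, hσ, hm, rfl⟩ := exists_eq_imageFace hkn F
  have hdim : Module.finrank ℝ (vectorSpan ℝ (faceVertices T (imageFace σ hσ hm))) = m := by
    rw [faceVertices_imageFace]
    exact (affineIndependent_points_comp T hσ).finrank_vectorSpan (by simp)
  have hle : Submodule.span ℝ (Set.range (ν k (imageFace σ hσ hm))) ≤
      (vectorSpan ℝ (faceVertices T (imageFace σ hσ hm)))ᗮ := by
    rw [Submodule.span_le]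
    rintro _ ⟨j, rfl⟩
    exact hν.orthogonal k hk hkn _ j
  have heq : Submodule.span ℝ (Set.range (ν k (imageFace σ hσ hm))) =
      (vectorSpan ℝ (faceVertices T (imageFace σ hσ hm)))ᗮ := by
    refine Submodule.eq_of_le_of_finrank_eq hle ?_
    rw [finrank_span_eq_card (hν.linearIndependent k hk hkn _)]
    have := Submodule.finrank_add_finrank_orthogonal
      (vectorSpan ℝ (faceVertices T (imageFace σ hσ hm)))
    rw [hdim, finrank_euclideanSpace_fin] at this
    simp only [Fintype.card_fin]
    omega
  rw [Submodule.span_union, hV, heq, sup_comm]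
  exact Submodule.sup_orthogonal_of_hasOrthogonalProjection

lemma span_edges_top (T : NSimplex n) :
    Submodule.span ℝ (Set.range T.points -ᵥ Set.range T.points) = ⊤ := by
  have h : affineSpan ℝ (Set.range T.points) = ⊤ := (vertexBasis T).tot
  have := congrArg AffineSubspace.direction h
  rwa [direction_affineSpan, AffineSubspace.direction_top] at this

/-- By multilinearity only words in a spanning set of directions matter. A word containing an edge
of the face is covered by `hedge`; a word in normals alone is a degree of freedom up to a nonzero
factor. -/
lemma simplexIntegral_derivList_eq_zero_of_edge {T : NSimplex n}
    {ν : (k : ℕ) → FaceOfCodim n k → Fin k → EuclideanSpace ℝ (Fin n)}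
    (hν : IsNormalFrame T ν) {p : MvPolynomial (Fin n) ℝ}
    (h : ∀ i, dof T ν i (polyFun n p) = 0) {m : ℕ} {σ : Fin (m + 1) → Fin (n + 1)}
    (hσ : Function.Injective σ)
    (hedge : ∀ i j, ∀ L : List (EuclideanSpace ℝ (Fin n)), L.length = m →
      simplexIntegral (T.points ∘ σ)
        (derivList ((T.points (σ j) - T.points (σ i)) :: L) p) = 0)
    (L : List (EuclideanSpace ℝ (Fin n))) (hL : L.length = m + 1) :
    simplexIntegral (T.points ∘ σ) (derivList L p) = 0 := by
  have hedge' : ∀ e ∈ Set.range (T.points ∘ σ) -ᵥ Set.range (T.points ∘ σ),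
      ∀ L : List (EuclideanSpace ℝ (Fin n)), L.length = m + 1 → e ∈ L →
        simplexIntegral (T.points ∘ σ) (derivList L p) = 0 := by
    rintro _ ⟨_, ⟨j, rfl⟩, _, ⟨i, rfl⟩, rfl⟩ L hL he
    obtain ⟨s, t, rfl⟩ := List.append_of_mem he
    rw [derivList_perm List.perm_middle]
    refine hedge i j _ ?_
    simp only [List.length_append, List.length_cons] at hL ⊢
    omega
  have hmn : m ≤ n := by
    simpa using Fintype.card_le_of_injective σ hσ
  rcases hmn.lt_or_eq with hlt | rfl
  · have hm : m + 1 = n + 1 - (n - m) := by omega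
    have hspan := span_normals_union_edges hν (k := n - m) (by omega) (by omega)
      (imageFace σ hσ hm)
    refine map_derivList_eq_zero_of_span hspan _ p (m + 1) (fun L hLX hL => ?_) L hL
    by_cases hex : ∃ e ∈ L, e ∈ Set.range (T.points ∘ σ) -ᵥ Set.range (T.points ∘ σ)
    · obtain ⟨e, heL, he⟩ := hex
      exact hedge' e he L hL heL
    · push Not at hex
      have hLν : ∀ e ∈ L, e ∈ Set.range (ν (n - m) (imageFace σ hσ hm)) := by
        intro e he
        rcases hLX e he with h1 | h1
        · exact h1
        · rw [faceVertices_imageFace] at h1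
          exact absurd h1 (hex e he)
      obtain ⟨J, rfl⟩ : ∃ J, List.map (ν (n - m) (imageFace σ hσ hm)) J = L := by
        rwa [← Set.mem_range, Set.range_list_map]
      have hJ : ∑ j, J.count j = n + 1 - (n - m) := by
        rw [sum_count_eq_length, ← hm, ← hL, List.length_map]
      have hd := h (Sum.inl ⟨⟨n - m, by omega, by omega⟩, imageFace σ hσ hm,
        ⟨fun j => J.count j, hJ⟩⟩)
      simp only [dof] at hd
      rw [iterDirDeriv_polyFun, faceAverage_imageFace,
        ← derivList_perm (map_perm_expandDirections _ J)] at hd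
      exact (mul_eq_zero.1 hd).resolve_left
        (inv_ne_zero (measureReal_cornerSimplex_pos m).ne')
  -- For m = n the face is T itself: there are no normals, and every word of positive length
  -- contains an edge.
  · have hspan := span_edges_top T
    rw [← ((Fintype.bijective_iff_injective_and_card σ).2 ⟨hσ, by simp⟩).surjective.range_comp
      T.points] at hspan
    refine map_derivList_eq_zero_of_span hspan _ p (m + 1) (fun L hLX hL => ?_) L hL
    obtain ⟨e, L', rfl⟩ := List.exists_cons_of_length_eq_add_one hL
    exact hedge' e (hLX e (by simp)) _ hL (by simp)

/-- If the averages of the normal derivatives vanish, so do the averages of all derivatives. -/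
lemma faceAveragesVanish_of_dof {T : NSimplex n}
    {ν : (k : ℕ) → FaceOfCodim n k → Fin k → EuclideanSpace ℝ (Fin n)}
    (hν : IsNormalFrame T ν) {p : MvPolynomial (Fin n) ℝ}
    (h : ∀ i, dof T ν i (polyFun n p) = 0) : FaceAveragesVanish T p := by
  intro m
  induction m with
  | zero =>
    intro σ hσ L hL
    refine simplexIntegral_derivList_eq_zero_of_edge hν h hσ (fun (i j : Fin 1) L _ => ?_) L hL
    -- The only edge vector of a vertex is zero.
    rw [Fin.fin_one_eq_zero i, Fin.fin_one_eq_zero j]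
    simp
  | succ m ih =>
    intro σ hσ L hL
    exact simplexIntegral_derivList_eq_zero_of_edge hν h hσ
      (fun i j L hL => simplexIntegral_derivList_edge_eq_zero ih hσ i j L hL) L hL

/-! ### Barycentric coordinates, the bubble, and constants with zero average -/

/-- The polynomial of degree at most one representing an affine function. -/
noncomputable def affinePoly (f : EuclideanSpace ℝ (Fin n) →ᵃ[ℝ] ℝ) : MvPolynomial (Fin n) ℝ :=
  C (f 0) + ∑ i, C (f.linear (EuclideanSpace.single i 1)) * X i

lemma linear_eq_sum_coord (f : EuclideanSpace ℝ (Fin n) →ₗ[ℝ] ℝ)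
    (x : EuclideanSpace ℝ (Fin n)) :
    f x = ∑ i, f (EuclideanSpace.single i 1) * x i := by
  have hx : x = ∑ i, x i • EuclideanSpace.single i (1 : ℝ) := by
    ext j
    simp [Pi.single_apply]
  conv_lhs => rw [hx]
  simp [mul_comm]

lemma polyFun_affinePoly (f : EuclideanSpace ℝ (Fin n) →ᵃ[ℝ] ℝ) :
    polyFun n (affinePoly f) = f := by
  ext x
  have : f x = f.linear x + f 0 := congrFun f.decomp x
  rw [this, linear_eq_sum_coord f.linear x]
  simp [polyFun_apply, affinePoly, add_comm]

lemma polyDeriv_affinePoly (f : EuclideanSpace ℝ (Fin n) →ᵃ[ℝ] ℝ)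
    (e : EuclideanSpace ℝ (Fin n)) :
    polyDeriv n e (affinePoly f) = C (f.linear e) := by
  rw [linear_eq_sum_coord f.linear e]
  simp [affinePoly, mul_comm]

lemma totalDegree_affinePoly_le (f : EuclideanSpace ℝ (Fin n) →ᵃ[ℝ] ℝ) :
    (affinePoly f).totalDegree ≤ 1 := by
  rw [← mem_restrictTotalDegree]
  refine Submodule.add_mem _ ?_ (Submodule.sum_mem _ fun i _ => ?_)
  · simp [mem_restrictTotalDegree]
  · rw [mem_restrictTotalDegree]
    refine (totalDegree_mul _ _).trans ?_
    simp

/-- The barycentric coordinate polynomials of `T`. -/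
noncomputable def baryPoly (T : NSimplex n) (i : Fin (n + 1)) : MvPolynomial (Fin n) ℝ :=
  affinePoly ((vertexBasis T).coord i)

lemma polyDeriv_baryPoly (T : NSimplex n) (i j k : Fin (n + 1)) :
    polyDeriv n (T.points j - T.points k) (baryPoly T i) =
      C ((if i = j then 1 else 0) - (if i = k then 1 else 0)) := by
  rw [baryPoly, polyDeriv_affinePoly, ← vsub_eq_sub, AffineMap.linearMap_vsub]
  congr 1
  have h : ∀ j, T.points j = vertexBasis T j := fun _ => rfl
  rw [h, h, AffineBasis.coord_apply, AffineBasis.coord_apply]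
  rfl

/-- The polynomial representing the bubble function. -/
noncomputable def bubblePoly (T : NSimplex n) : MvPolynomial (Fin n) ℝ := ∏ i, baryPoly T i

lemma polyFun_bubblePoly (T : NSimplex n) : polyFun n (bubblePoly T) = bubble T := by
  ext x
  simp only [bubble, polyFun_apply, bubblePoly, map_prod]
  refine Finset.prod_congr rfl fun i _ => ?_
  exact congrFun (polyFun_affinePoly _) x

lemma totalDegree_bubblePoly_le (T : NSimplex n) : (bubblePoly T).totalDegree ≤ n + 1 := by
  refine (totalDegree_finsetProd _ _).trans ?_
  refine (Finset.sum_le_card_nsmul _ _ 1 fun i _ => totalDegree_affinePoly_le _).trans ?_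
  simp

/-- Such a derivative is a constant, and its integral over any face with as many vertices as its
order is zero. The bound n+1 on the order guarantees that such a face exists. This is the step of
every descent below. -/
lemma FaceAveragesVanish.derivList_eq_zero {T : NSimplex n} {v : MvPolynomial (Fin n) ℝ}
    (hv : FaceAveragesVanish T v) {L : List (EuclideanSpace ℝ (Fin n))} (h0 : 1 ≤ L.length)
    (h1 : L.length ≤ n + 1) (h : ∀ e, polyDeriv n e (derivList L v) = 0) :
    derivList L v = 0 := by
  obtain ⟨m, hm⟩ := Nat.exists_eq_add_of_le' h0
  have hinj := Fin.castLE_injective (hm ▸ h1)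
  have := hv m _ hinj L hm
  have hc := eq_C_of_forall_polyDeriv_eq_zero h 0
  rw [hc, simplexIntegral_C] at this
  rw [hc, (mul_eq_zero.1 this).resolve_left (measureReal_cornerSimplex_pos m).ne', C_0]

/-! ### Derivatives along the edges from one vertex -/

/-- The edge vectors from the initial vertex in the ordering `σ` of the vertices. -/
noncomputable def edgeDir (T : NSimplex (N + 1)) (σ : Equiv.Perm (Fin (N + 2)))
    (i : Fin (N + 1)) : EuclideanSpace ℝ (Fin (N + 1)) :=
  T.points (σ i.succ) - T.points (σ 0)

lemma polyDeriv_edgeDir_baryPoly (T : NSimplex (N + 1)) (σ : Equiv.Perm (Fin (N + 2)))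
    (i : Fin (N + 1)) (k : Fin (N + 2)) :
    polyDeriv (N + 1) (edgeDir T σ i) (baryPoly T (σ k)) =
      C ((if k = i.succ then 1 else 0) - (if k = 0 then 1 else 0)) := by
  rw [edgeDir, polyDeriv_baryPoly]
  simp only [EmbeddingLike.apply_eq_iff_eq]

lemma span_edgeDir (T : NSimplex (N + 1)) (σ : Equiv.Perm (Fin (N + 2))) :
    Submodule.span ℝ (Set.range (edgeDir T σ)) = ⊤ := by
  have h := span_edges_top T
  rw [← σ.surjective.range_comp] at h
  rw [eq_top_iff, ← h, Submodule.span_le]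
  have h0 : ∀ i, T.points (σ i) - T.points (σ 0) ∈
      Submodule.span ℝ (Set.range (edgeDir T σ)) := by
    intro i
    induction i using Fin.cases with
    | zero => simp
    | succ i => exact Submodule.subset_span ⟨i, rfl⟩
  rintro _ ⟨_, ⟨i, rfl⟩, _, ⟨j, rfl⟩, rfl⟩
  have := Submodule.sub_mem _ (h0 i) (h0 j)
  simpa using this

lemma polyDeriv_eq_zero_of_span {X : Set (EuclideanSpace ℝ (Fin n))}
    (hX : Submodule.span ℝ X = ⊤) {p : MvPolynomial (Fin n) ℝ}
    (h : ∀ e ∈ X, polyDeriv n e p = 0) (e : EuclideanSpace ℝ (Fin n)) : polyDeriv n e p = 0 := by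
  have he : e ∈ Submodule.span ℝ X := hX ▸ Submodule.mem_top
  induction he using Submodule.span_induction with
  | mem e he => exact h e he
  | zero => simp
  | add e f _ _ h1 h2 => simp [h1, h2]
  | smul c e _ h1 => simp [h1]

/-- The product of the barycentric coordinates of the vertices opposite to the initial edge. -/
noncomputable def tailProd (T : NSimplex (N + 1)) (σ : Equiv.Perm (Fin (N + 2)))
    (S : Finset (Fin N)) : MvPolynomial (Fin (N + 1)) ℝ :=
  ∏ i ∈ S, baryPoly T (σ i.succ.succ)

lemma bubblePoly_eq (T : NSimplex (N + 1)) (σ : Equiv.Perm (Fin (N + 2))) :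
    bubblePoly T = baryPoly T (σ 0) * baryPoly T (σ 1) * tailProd T σ Finset.univ := by
  rw [bubblePoly, ← Equiv.prod_comp σ, Fin.prod_univ_succ, Fin.prod_univ_succ, tailProd,
    mul_assoc]
  rfl

lemma polyDeriv_zero_tailProd (T : NSimplex (N + 1)) (σ : Equiv.Perm (Fin (N + 2)))
    (S : Finset (Fin N)) : polyDeriv (N + 1) (edgeDir T σ 0) (tailProd T σ S) = 0 := by
  induction S using Finset.induction_on with
  | empty => simp [tailProd]
  | insert i S hi ih =>
    unfold tailProd at ih ⊢
    rw [Finset.prod_insert hi, Derivation.leibniz, ih, polyDeriv_edgeDir_baryPoly]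
    simp [Fin.ext_iff]

/-- Among the factors, only the barycentric coordinate of the far end of the edge varies along it,
with derivative 1; the initial vertex contributes no factor. -/
lemma polyDeriv_succ_tailProd (T : NSimplex (N + 1)) (σ : Equiv.Perm (Fin (N + 2)))
    (S : Finset (Fin N)) (j : Fin N) :
    polyDeriv (N + 1) (edgeDir T σ j.succ) (tailProd T σ S) =
      if j ∈ S then tailProd T σ (S.erase j) else 0 := by
  have hnot : ∀ S : Finset (Fin N), j ∉ S →
      polyDeriv (N + 1) (edgeDir T σ j.succ) (tailProd T σ S) = 0 := by
    intro S
    induction S using Finset.induction_on with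
    | empty => simp [tailProd]
    | insert i S hi ih =>
      intro hj
      rw [Finset.mem_insert, not_or] at hj
      have ih' := ih hj.2
      unfold tailProd at ih' ⊢
      rw [Finset.prod_insert hi, Derivation.leibniz, ih', polyDeriv_edgeDir_baryPoly]
      simp [Ne.symm hj.1]
  split_ifs with hj
  · have h1 : tailProd T σ S = baryPoly T (σ j.succ.succ) * tailProd T σ (S.erase j) :=
      (Finset.mul_prod_erase S (fun i : Fin N => baryPoly T (σ i.succ.succ)) hj).symm
    rw [h1, Derivation.leibniz, hnot _ (Finset.notMem_erase j S), polyDeriv_edgeDir_baryPoly]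
    simp
  · exact hnot S hj

/-- The iterated derivative along the edges with labels in the list `J`. -/
noncomputable def edgeDeriv (T : NSimplex (N + 1)) (σ : Equiv.Perm (Fin (N + 2)))
    (J : List (Fin (N + 1))) (p : MvPolynomial (Fin (N + 1)) ℝ) : MvPolynomial (Fin (N + 1)) ℝ :=
  derivList (J.map (edgeDir T σ)) p

lemma edgeDeriv_cons (T : NSimplex (N + 1)) (σ : Equiv.Perm (Fin (N + 2))) (j : Fin (N + 1))
    (J : List (Fin (N + 1))) (p : MvPolynomial (Fin (N + 1)) ℝ) :
    edgeDeriv T σ (j :: J) p = polyDeriv (N + 1) (edgeDir T σ j) (edgeDeriv T σ J p) := rfl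

lemma edgeDeriv_perm (T : NSimplex (N + 1)) (σ : Equiv.Perm (Fin (N + 2)))
    {J K : List (Fin (N + 1))} (h : J.Perm K) (p : MvPolynomial (Fin (N + 1)) ℝ) :
    edgeDeriv T σ J p = edgeDeriv T σ K p := derivList_perm (h.map _) p

lemma edgeDeriv_append (T : NSimplex (N + 1)) (σ : Equiv.Perm (Fin (N + 2)))
    (J K : List (Fin (N + 1))) (p : MvPolynomial (Fin (N + 1)) ℝ) :
    edgeDeriv T σ (J ++ K) p = edgeDeriv T σ J (edgeDeriv T σ K p) := by
  simp [edgeDeriv, derivList_append]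

lemma edgeDeriv_map_succ_tailProd (T : NSimplex (N + 1)) (σ : Equiv.Perm (Fin (N + 2)))
    (J : List (Fin N)) :
    edgeDeriv T σ (J.map Fin.succ) (tailProd T σ Finset.univ) =
      if J.Nodup then tailProd T σ (Finset.univ \ J.toFinset) else 0 := by
  induction J with
  | nil => simp [edgeDeriv]
  | cons j J ih =>
    rw [List.map_cons, edgeDeriv_cons, ih]
    by_cases hJ : J.Nodup
    · rw [if_pos hJ, polyDeriv_succ_tailProd]
      by_cases hj : j ∈ J
      · simp [hj]
      · rw [if_pos (by simpa using hj), if_pos (List.nodup_cons.2 ⟨hj, hJ⟩)]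
        congr 1
        ext i
        simp [not_or]
    · simp [hJ]

/-- Lists of edge labels which contain the initial edge or a repetition. -/
def IsDegenerate (J : List (Fin (N + 1))) : Prop := 0 ∈ J ∨ ¬ J.Nodup

lemma IsDegenerate.cons {J : List (Fin (N + 1))} (h : IsDegenerate J) (j : Fin (N + 1)) :
    IsDegenerate (j :: J) := by
  rcases h with h | h
  · exact Or.inl (List.mem_cons_of_mem _ h)
  · exact Or.inr fun h' => h (List.nodup_cons.1 h').2

/-- The product is constant along the initial edge and affine along each of the others. -/
lemma edgeDeriv_tailProd_of_isDegenerate (T : NSimplex (N + 1)) (σ : Equiv.Perm (Fin (N + 2)))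
    {J : List (Fin (N + 1))} (h : IsDegenerate J) :
    edgeDeriv T σ J (tailProd T σ Finset.univ) = 0 := by
  by_cases h0 : 0 ∈ J
  · obtain ⟨s, t, rfl⟩ := List.append_of_mem h0
    rw [edgeDeriv_perm T σ (List.perm_middle.trans (List.perm_append_singleton _ _).symm),
      edgeDeriv_append, edgeDeriv_cons]
    simp [edgeDeriv, polyDeriv_zero_tailProd]
  · obtain ⟨K, rfl⟩ : J ∈ Set.range (List.map Fin.succ) := by
      rw [Set.range_list_map]
      intro i hi
      exact Fin.exists_succ_eq.2 fun h' => h0 (h' ▸ hi)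
    rw [edgeDeriv_map_succ_tailProd, if_neg]
    intro hK
    exact (h.resolve_left h0) (hK.map (Fin.succ_injective _))

/-- The third derivative along the initial edge, applied to the degree `n + 2` part. -/
lemma edgeDeriv_three_bubblePoly_mul (T : NSimplex (N + 1)) (σ : Equiv.Perm (Fin (N + 2)))
    {l : MvPolynomial (Fin (N + 1)) ℝ} {a : ℝ}
    (hl : polyDeriv (N + 1) (edgeDir T σ 0) l = C a) :
    edgeDeriv T σ [0, 0, 0] (bubblePoly T * l) = (-6 * a) • tailProd T σ Finset.univ := by
  have h0 := polyDeriv_edgeDir_baryPoly T σ 0 0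
  have h1 := polyDeriv_edgeDir_baryPoly T σ 0 1
  have ht := polyDeriv_zero_tailProd T σ Finset.univ
  simp only [Fin.succ_zero_eq_one, if_true, one_ne_zero, zero_ne_one, if_false, zero_sub, sub_zero,
    C_neg, C_1] at h0 h1
  -- Along the initial edge the three varying factors are affine with slopes -1, 1 and a, so the
  -- third derivative of their product is 3! · (-1) · 1 · a.
  rw [bubblePoly_eq T σ]
  simp only [edgeDeriv, List.map_cons, List.map_nil, derivList_cons, derivList_nil,
    Derivation.leibniz, map_add, h0, h1, ht, hl, smul_eq_mul, mul_zero, zero_add, add_zero,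
    mul_one, mul_neg, map_neg, polyDeriv_C, neg_zero, smul_eq_C_mul, C_mul,
    Derivation.map_one_eq_zero]
  have : (C (6 : ℝ) : MvPolynomial (Fin (N + 1)) ℝ) = 6 := map_ofNat C 6
  rw [this]
  ring

/-! ### Constancy of the affine factor -/

/-- The degree bounds `deg p ≤ n + 1` and `deg l ≤ 1` for a shape function `p + q_T l`. -/
structure IsShapePair (p l : MvPolynomial (Fin n) ℝ) : Prop where
  left : p.totalDegree ≤ n + 1
  right : l.totalDegree ≤ 1

/-- With n = N + 1 the order N + 3 is n + 2, which exceeds the degree of `p`; only the bubble term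
survives. -/
lemma IsShapePair.edgeDeriv_eq {p l : MvPolynomial (Fin (N + 1)) ℝ}
    (h : IsShapePair p l) (T : NSimplex (N + 1)) (σ : Equiv.Perm (Fin (N + 2))) {a : ℝ}
    (hl : polyDeriv (N + 1) (edgeDir T σ 0) l = C a) {J : List (Fin (N + 1))}
    (hJ : J.length = N) :
    edgeDeriv T σ (J ++ [0, 0, 0]) (p + bubblePoly T * l) =
      (-6 * a) • edgeDeriv T σ J (tailProd T σ Finset.univ) := by
  have hp : edgeDeriv T σ (J ++ [0, 0, 0]) p = 0 := by
    refine derivList_eq_zero_of_totalDegree_lt _ (h.left.trans_lt ?_)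
    simp [hJ]
  have hadd : ∀ K (q r : MvPolynomial (Fin (N + 1)) ℝ),
    edgeDeriv T σ K (q + r) = edgeDeriv T σ K q + edgeDeriv T σ K r :=
    fun K q r => derivList_add _ q r
  rw [hadd, hp, zero_add, edgeDeriv_append, edgeDeriv_three_bubblePoly_mul T σ hl]
  exact derivList_smul _ _ _

lemma IsShapePair.totalDegree_le {p l : MvPolynomial (Fin n) ℝ}
    (h : IsShapePair p l) (T : NSimplex n) : (p + bubblePoly T * l).totalDegree ≤ n + 2 := by
  refine (totalDegree_add _ _).trans (max_le (h.left.trans (by omega)) ?_)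
  refine (totalDegree_mul _ _).trans ?_
  have := totalDegree_bubblePoly_le T
  have := h.right
  omega

/-- Descent on the length of `J`, starting at total order n + 2, where the product of the remaining
barycentric coordinates decides. Degeneracy survives prepending any direction, so one order lower
the derivative is constant and its zero average applies. Beyond order n + 2 the degree suffices. -/
lemma edgeDeriv_eq_zero_of_isDegenerate {T : NSimplex (N + 1)}
    {p l : MvPolynomial (Fin (N + 1)) ℝ} (h : IsShapePair p l)
    (hv : FaceAveragesVanish T (p + bubblePoly T * l)) (σ : Equiv.Perm (Fin (N + 2)))
    {J : List (Fin (N + 1))} (hJ : IsDegenerate J) :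
    edgeDeriv T σ (J ++ [0, 0, 0]) (p + bubblePoly T * l) = 0 := by
  by_cases hlen : J.length ≤ N
  · obtain ⟨d, hd⟩ := Nat.exists_eq_add_of_le hlen
    induction d generalizing J with
    | zero =>
      have hl := totalDegree_eq_zero_iff_eq_C.1
        (Nat.le_zero.1 (totalDegree_polyDeriv_le h.right (edgeDir T σ 0)))
      rw [h.edgeDeriv_eq T σ hl (by omega), edgeDeriv_tailProd_of_isDegenerate T σ hJ, smul_zero]
    | succ d ih =>
      refine hv.derivList_eq_zero (by simp) (by simp; omega) ?_
      refine polyDeriv_eq_zero_of_span (span_edgeDir T σ) ?_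
      rintro _ ⟨i, rfl⟩
      exact ih (hJ.cons i) (by simp; omega) (by simp; omega)
  · refine derivList_eq_zero_of_totalDegree_lt _ ((h.totalDegree_le T).trans_lt ?_)
    simp
    omega

/-- A polynomial whose third derivative along an edge is constant on the edge, with equal values
at the endpoints and vanishing derivatives there. -/
lemma third_deriv_eq_zero {v : MvPolynomial (Fin n) ℝ} {x e : EuclideanSpace ℝ (Fin n)}
    (h0 : polyFun n v (x + e) = polyFun n v x) (h1 : polyFun n (polyDeriv n e v) x = 0)
    (h2 : polyFun n (polyDeriv n e v) (x + e) = 0) {c : ℝ}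
    (h3 : ∀ t : ℝ, polyFun n (polyDeriv n e (polyDeriv n e (polyDeriv n e v))) (x + t • e) = c) :
    c = 0 := by
  set B := polyFun n (polyDeriv n e (polyDeriv n e v)) x
  have hB : ∀ t : ℝ, polyFun n (polyDeriv n e (polyDeriv n e v)) (x + t • e) = B + c * t :=
    polyFun_line_of_deriv_const h3
  have hA : ∀ t : ℝ, polyFun n (polyDeriv n e v) (x + t • e) = B * t + c * t ^ 2 / 2 := by
    intro t
    have hd : ∀ s : ℝ, HasDerivAt (fun s : ℝ => polyFun n (polyDeriv n e v) (x + s • e) -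
        (B * s + c * s ^ 2 / 2)) 0 s := by
      intro s
      have h := (hasDerivAt_polyFun_line (polyDeriv n e v) x e s).fun_sub
        (((hasDerivAt_id s).const_mul B).fun_add
          ((((hasDerivAt_id s).pow 2).const_mul c).div_const 2))
      refine (h.congr_deriv ?_)
      rw [hB]
      simp
      ring
    have := is_const_of_deriv_eq_zero (fun s => (hd s).differentiableAt) (fun s => (hd s).deriv) t 0
    simp [h1] at this
    linarith
  have hv : ∀ t : ℝ, polyFun n v (x + t • e) = polyFun n v x + (B * t ^ 2 / 2 + c * t ^ 3 / 6) := by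
    intro t
    have hd : ∀ s : ℝ, HasDerivAt (fun s : ℝ => polyFun n v (x + s • e) -
        (B * s ^ 2 / 2 + c * s ^ 3 / 6)) 0 s := by
      intro s
      have h := (hasDerivAt_polyFun_line v x e s).fun_sub
        (((((hasDerivAt_id s).pow 2).const_mul B).div_const 2).fun_add
          ((((hasDerivAt_id s).pow 3).const_mul c).div_const 6))
      refine (h.congr_deriv ?_)
      rw [hA]
      simp
      ring
    have := is_const_of_deriv_eq_zero (fun s => (hd s).differentiableAt) (fun s => (hd s).deriv) t 0
    simp at this
    linarith
  -- At t = 1 the conditions read B + c/2 = 0 and B/2 + c/6 = 0, which force c = 0.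
  have e1 := hA 1
  have e2 := hv 1
  rw [one_smul] at e1 e2
  rw [h2] at e1
  rw [h0] at e2
  linarith

/-- The fourth derivative along the edge is degenerate, so v is a cubic there. The case m = 0 of the
face averages gives vanishing gradients at the vertices, and these four endpoint conditions leave no
cubic term. -/
lemma edgeDeriv_along_initial_edge_eq_zero {T : NSimplex (N + 1)}
    {p l : MvPolynomial (Fin (N + 1)) ℝ} (h : IsShapePair p l)
    (hv : FaceAveragesVanish T (p + bubblePoly T * l)) (σ : Equiv.Perm (Fin (N + 2)))
    (hvert : polyFun (N + 1) (p + bubblePoly T * l) (T.points (σ 1)) =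
      polyFun (N + 1) (p + bubblePoly T * l) (T.points (σ 0))) :
    polyFun (N + 1) (edgeDeriv T σ [0, 0, 0] (p + bubblePoly T * l)) (T.points (σ 0)) = 0 := by
  have hgrad : ∀ i, polyFun (N + 1) (polyDeriv (N + 1) (edgeDir T σ 0) (p + bubblePoly T * l))
      (T.points i) = 0 := by
    intro i
    have := hv 0 (fun _ => i) (Function.injective_of_subsingleton (α := Fin 1) _)
      [edgeDir T σ 0] rfl
    rw [simplexIntegral_zero_dim] at this
    exact (mul_eq_zero.1 this).resolve_left (measureReal_cornerSimplex_pos 0).ne'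
  have hadd : T.points (σ 0) + edgeDir T σ 0 = T.points (σ 1) := by
    simp [edgeDir]
  refine third_deriv_eq_zero (v := p + bubblePoly T * l) (e := edgeDir T σ 0) (by rw [hadd, hvert])
    (hgrad _) (by rw [hadd]; exact hgrad _) (fun t => ?_)
  have hd : IsDegenerate (N := N) [0] := Or.inl (by simp)
  have := edgeDeriv_eq_zero_of_isDegenerate h hv σ hd
  have h2 := polyFun_line_of_deriv_const (x := T.points (σ 0)) (c := 0)
    (p := edgeDeriv T σ [0, 0, 0] (p + bubblePoly T * l)) (e := edgeDir T σ 0) (fun s => by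
      have h3 : polyDeriv (N + 1) (edgeDir T σ 0)
        (edgeDeriv T σ [0, 0, 0] (p + bubblePoly T * l)) = 0 := this
      simp [h3]) t
  rw [zero_mul, add_zero] at h2
  exact h2

/-- The vertices of the sub-simplex spanned by the initial edge, the vertex `j` and those in `J`. -/
def chainVertex (j : Fin N) (J : List (Fin N)) : Fin (J.length + 3) → Fin (N + 2) :=
  Fin.cons 0 (Fin.cons 1 (Fin.cons j.succ.succ fun k => (J.get k).succ.succ))

lemma chainVertex_injective {j : Fin N} {J : List (Fin N)} (h : (j :: J).Nodup) :
    Function.Injective (chainVertex j J) := by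
  rw [List.nodup_cons] at h
  unfold chainVertex
  rw [Fin.cons_injective_iff, Fin.cons_injective_iff, Fin.cons_injective_iff]
  refine ⟨?_, ?_, ?_, ?_⟩
  · rintro ⟨k, hk⟩
    revert hk
    refine Fin.cases ?_ (fun k => ?_) k
    · simp
    · refine Fin.cases ?_ (fun k => ?_) k
      · simp
      · simp
  · rintro ⟨k, hk⟩
    revert hk
    refine Fin.cases ?_ (fun k => ?_) k
    · simp [Fin.ext_iff]
    · simp [Fin.ext_iff]
  · rintro ⟨k, hk⟩
    have := Fin.succ_injective _ (Fin.succ_injective _ hk)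
    exact h.1 (this ▸ J.get_mem k)
  · intro k k' hk
    have := Fin.succ_injective _ (Fin.succ_injective _ hk)
    exact h.2.injective_get this

/-- The displacement is grouped as the new direction `j`, with coordinate `y 1`, followed by the
directions along which the derivative in question is constant. -/
lemma simplexParam_chainVertex (T : NSimplex (N + 1)) (σ : Equiv.Perm (Fin (N + 2))) (j : Fin N)
    (J : List (Fin N)) (y : Fin (J.length + 2) → ℝ) :
    simplexParam (T.points ∘ σ ∘ chainVertex j J) y =
      T.points (σ 0) + y 1 • edgeDir T σ j.succ +
        (y 0 • edgeDir T σ 0 +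
          ∑ k : Fin J.length, y k.succ.succ • edgeDir T σ (J.get k).succ) := by
  simp only [simplexParam, Fin.sum_univ_succ, chainVertex, Function.comp_apply, Fin.cons_zero,
    Fin.cons_succ, edgeDir, Fin.succ_zero_eq_one]
  abel

/-- Induction on `J`. Let G be the derivative already known to vanish at the initial vertex.
Differentiating G along the initial edge, along a direction in `J`, or twice along `j` gives a
degenerate word, so on the face of `chainVertex j J` G equals γ times the coordinate of `j`. This
face has |J| + 3 vertices, the order of G, so G has zero integral over it; the coordinate has
positive integral, hence γ = 0. -/
lemma edgeDeriv_nondegenerate_eq_zero {T : NSimplex (N + 1)}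
    {p l : MvPolynomial (Fin (N + 1)) ℝ} (h : IsShapePair p l)
    (hv : FaceAveragesVanish T (p + bubblePoly T * l)) (σ : Equiv.Perm (Fin (N + 2)))
    (hvert : polyFun (N + 1) (p + bubblePoly T * l) (T.points (σ 1)) =
      polyFun (N + 1) (p + bubblePoly T * l) (T.points (σ 0)))
    {J : List (Fin N)} (hJ : J.Nodup) :
    polyFun (N + 1) (edgeDeriv T σ (J.map Fin.succ ++ [0, 0, 0]) (p + bubblePoly T * l))
      (T.points (σ 0)) = 0 := by
  induction J with
  | nil => exact edgeDeriv_along_initial_edge_eq_zero h hv σ hvert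
  | cons j J ih =>
    have ih' := ih (List.nodup_cons.1 hJ).2
    set v := p + bubblePoly T * l with hvdef
    set G := edgeDeriv T σ (J.map Fin.succ ++ [0, 0, 0]) v with hG
    have hH : edgeDeriv T σ ((j :: J).map Fin.succ ++ [0, 0, 0]) v =
        polyDeriv (N + 1) (edgeDir T σ j.succ) G := rfl
    rw [hH]
    set γ := polyFun (N + 1) (polyDeriv (N + 1) (edgeDir T σ j.succ) G) (T.points (σ 0)) with hγ
    have hG0 : polyDeriv (N + 1) (edgeDir T σ 0) G = 0 :=
      edgeDeriv_eq_zero_of_isDegenerate h hv σ (J := 0 :: J.map Fin.succ) (Or.inl (by simp))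
    have hGJ : ∀ i ∈ J, polyDeriv (N + 1) (edgeDir T σ i.succ) G = 0 := fun i hi =>
      edgeDeriv_eq_zero_of_isDegenerate h hv σ (J := i.succ :: J.map Fin.succ)
        (Or.inr fun hn => (List.nodup_cons.1 hn).1 (List.mem_map_of_mem hi))
    have hHj : polyDeriv (N + 1) (edgeDir T σ j.succ)
        (polyDeriv (N + 1) (edgeDir T σ j.succ) G) = 0 :=
      edgeDeriv_eq_zero_of_isDegenerate h hv σ (J := j.succ :: j.succ :: J.map Fin.succ)
        (Or.inr fun hn => (List.nodup_cons.1 hn).1 (by simp))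
    have hline : ∀ t : ℝ, polyFun (N + 1) G (T.points (σ 0) + t • edgeDir T σ j.succ) = γ * t := by
      intro t
      -- The slope is γ all along the line because the second derivative along `j` vanishes, and the
      -- starting value is zero by the induction hypothesis.
      rw [polyFun_line_of_deriv_const (c := γ) (fun s => ?_), ih', zero_add]
      rw [polyFun_line_of_deriv_const (c := 0) (fun s => by simp [hHj]), zero_mul, add_zero]
    have hparam : ∀ y : Fin (J.length + 2) → ℝ,
        polyFun (N + 1) G (simplexParam (T.points ∘ σ ∘ chainVertex j J) y) = γ * y 1 := by
      intro y
      rw [simplexParam_chainVertex, polyFun_add_of_polyDeriv_eq_zero, hline]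
      simp only [map_add, map_smul, map_sum, Derivation.add_apply, Derivation.smul_apply, hG0,
        smul_zero, zero_add]
      rw [← Derivation.coeFnAddMonoidHom_apply, map_sum, Finset.sum_apply]
      refine Finset.sum_eq_zero fun k _ => ?_
      have hk : polyDeriv (N + 1) (edgeDir T σ (J.get k).succ) G = 0 := hGJ _ (J.get_mem k)
      change (y k.succ.succ • polyDeriv (N + 1) (edgeDir T σ (J.get k).succ)) G = 0
      rw [Derivation.smul_apply, hk, smul_zero]
    have hint := hv _ _ (σ.injective.comp (chainVertex_injective hJ))
      ((J.map Fin.succ ++ [0, 0, 0]).map (edgeDir T σ)) (by simp)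
    change simplexIntegral (T.points ∘ σ ∘ chainVertex j J) G = 0 at hint
    rw [simplexIntegral_apply] at hint
    simp only [hparam] at hint
    rw [integral_const_mul] at hint
    exact (mul_eq_zero.1 hint).resolve_right (integral_coord_cornerSimplex_pos _).ne'

/-- The affine factor of a shape function with vanishing face averages and equal vertex values
is constant along every edge. -/
lemma polyDeriv_edge_affineFactor_eq_zero {T : NSimplex (N + 1)}
    {p l : MvPolynomial (Fin (N + 1)) ℝ} (h : IsShapePair p l)
    (hv : FaceAveragesVanish T (p + bubblePoly T * l)) (σ : Equiv.Perm (Fin (N + 2)))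
    (hvert : polyFun (N + 1) (p + bubblePoly T * l) (T.points (σ 1)) =
      polyFun (N + 1) (p + bubblePoly T * l) (T.points (σ 0))) :
    polyDeriv (N + 1) (edgeDir T σ 0) l = 0 := by
  have hl := totalDegree_eq_zero_iff_eq_C.1
    (Nat.le_zero.1 (totalDegree_polyDeriv_le h.right (edgeDir T σ 0)))
  have h1 := edgeDeriv_nondegenerate_eq_zero h hv σ hvert (List.nodup_finRange N)
  rw [h.edgeDeriv_eq T σ hl (by simp), edgeDeriv_map_succ_tailProd,
    if_pos (List.nodup_finRange N)] at h1
  have h2 : (Finset.univ \ (List.finRange N).toFinset : Finset (Fin N)) = ∅ := by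
    ext; simp
  rw [h2] at h1
  -- The remaining product is empty, so `h1` says that -6 times the slope of `l` along the edge is
  -- zero.
  simp [tailProd, polyFun_apply] at h1
  rw [hl, h1, C_0]

lemma affineFactor_eq_C {T : NSimplex (N + 1)}
    {p l : MvPolynomial (Fin (N + 1)) ℝ} (h : IsShapePair p l)
    (hv : FaceAveragesVanish T (p + bubblePoly T * l))
    (hvert : ∀ i, polyFun (N + 1) (p + bubblePoly T * l) (T.points i) = 0) :
    ∃ c, l = C c := by
  refine ⟨_, eq_C_of_forall_polyDeriv_eq_zero (polyDeriv_eq_zero_of_span (span_edges_top T) ?_) 0⟩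
  rintro _ ⟨_, ⟨j, rfl⟩, _, ⟨i, rfl⟩, rfl⟩
  by_cases hij : i = j
  · simp [hij]
  obtain ⟨σ, rfl, rfl⟩ := exists_perm_zero_one hij
  exact polyDeriv_edge_affineFactor_eq_zero h hv σ (by rw [hvert, hvert])

/-- A polynomial of degree at most `n + 1` with vanishing face averages and vertex values is
zero. -/
lemma eq_zero_of_faceAveragesVanish {T : NSimplex n} {v : MvPolynomial (Fin n) ℝ}
    (hdeg : v.totalDegree ≤ n + 1) (hv : FaceAveragesVanish T v)
    (hvert : polyFun n v (T.points 0) = 0) : v = 0 := by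
  -- Downward induction on the order r, starting at n + 2 > deg v.
  have key : ∀ d r, r + d = n + 2 → 1 ≤ r → ∀ L : List (EuclideanSpace ℝ (Fin n)),
      L.length = r → derivList L v = 0 := by
    intro d
    induction d with
    | zero =>
      intro r hr _ L hL
      exact derivList_eq_zero_of_totalDegree_lt _ (by omega)
    | succ d ih =>
      intro r hr h1 L hL
      exact hv.derivList_eq_zero (by omega) (by omega) fun e =>
        ih (r + 1) (by omega) (by omega) (e :: L) (by simp [hL])
  have h := eq_C_of_forall_polyDeriv_eq_zero (p := v)
    (fun e => key (n + 1) 1 (by omega) le_rfl [e] rfl) (T.points 0)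
  rw [h, hvert, C_0]

lemma shapePair_eq_zero {T : NSimplex (N + 1)} {p l : MvPolynomial (Fin (N + 1)) ℝ}
    (h : IsShapePair p l) (hv : FaceAveragesVanish T (p + bubblePoly T * l))
    (hvert : ∀ i, polyFun (N + 1) (p + bubblePoly T * l) (T.points i) = 0) :
    p + bubblePoly T * l = 0 := by
  refine eq_zero_of_faceAveragesVanish ?_ hv (hvert 0)
  obtain ⟨c, rfl⟩ := affineFactor_eq_C h hv hvert
  refine (totalDegree_add _ _).trans (max_le h.left ?_)
  refine (totalDegree_mul _ _).trans ?_
  rw [totalDegree_C, add_zero]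
  exact totalDegree_bubblePoly_le T

/-! ### Counting monomials and degrees of freedom -/

lemma natCard_sum_eq (k m : ℕ) :
    Nat.card {α : Fin k → ℕ // ∑ j, α j = m} = k.multichoose m := by
  rw [← Nat.card_congr (Sym.equivNatSumOfFintype (Fin k) m), Sym.natCard_sym_eq_multichoose,
    Nat.card_fin]

lemma natCard_sum_le_eq (n d : ℕ) :
    Nat.card {s : Fin n →₀ ℕ // (s.sum fun _ e => e) ≤ d} = (n + d).choose n := by
  -- A slack exponent d - ∑ s turns the inequality into an equality in one more variable.
  let e : {s : Fin n →₀ ℕ // (s.sum fun _ e => e) ≤ d} ≃ {α : Fin (n + 1) → ℕ // ∑ j, α j = d} :=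
    { toFun := fun s => ⟨Fin.cons (d - ∑ i, s.1 i) s.1, by
        have h := s.2
        rw [Finsupp.sum_fintype _ _ fun _ => rfl] at h
        simp only [Fin.sum_univ_succ, Fin.cons_zero, Fin.cons_succ]
        omega⟩
      invFun := fun α => ⟨Finsupp.equivFunOnFinite.symm fun i => α.1 i.succ, by
        have h := α.2
        rw [Fin.sum_univ_succ] at h
        rw [Finsupp.sum_fintype _ _ fun _ => rfl]
        simp only [Finsupp.equivFunOnFinite_symm_apply_apply]
        omega⟩
      left_inv := fun s => by
        apply Subtype.ext
        ext i
        simp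
      right_inv := fun α => by
        apply Subtype.ext
        have h := α.2
        rw [Fin.sum_univ_succ] at h
        funext i
        induction i using Fin.cases with
        | zero => simp; omega
        | succ i => simp }
  rw [Nat.card_congr e, natCard_sum_eq, Nat.multichoose_eq]
  rw [show n + 1 + d - 1 = n + d by omega, Nat.choose_symm_add]

lemma finrank_restrictTotalDegree (n d : ℕ) :
    Module.finrank ℝ (restrictTotalDegree (Fin n) ℝ d) = (n + d).choose n := by
  rw [restrictTotalDegree, Module.finrank_eq_nat_card_basis (basisRestrictSupport ℝ _)]
  exact natCard_sum_le_eq n d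

/-- Codimension k contributes C(n+1, k) C(n, k-1). Summed over 1 ≤ k ≤ n this is Vandermonde's
expansion of C(2n+1, n) without the term k = n + 1, which equals 1; the n + 1 vertex values turn
that deficit into + n. -/
lemma natCard_DOFIndex (n : ℕ) : Nat.card (DOFIndex n) = (2 * n + 1).choose n + n := by
  have hfin : ∀ k : {k : ℕ // 1 ≤ k ∧ k ≤ n}, Finite (NormalMultiIndex n k.1) := fun k =>
    Finite.of_equiv _ (Sym.equivNatSumOfFintype (Fin k.1) (n + 1 - k.1))
  have hfin' : Finite {k : ℕ // 1 ≤ k ∧ k ≤ n} := inferInstanceAs (Finite (Set.Icc 1 n))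
  have := Fintype.ofFinite {k : ℕ // 1 ≤ k ∧ k ≤ n}
  rw [Nat.card_sum, Nat.card_sigma, Nat.card_fin]
  have hterm : ∀ k : {k : ℕ // 1 ≤ k ∧ k ≤ n},
      Nat.card (FaceOfCodim n k.1 × NormalMultiIndex n k.1) =
        (n + 1).choose k.1 * n.choose (k.1 - 1) := by
    rintro ⟨k, hk1, hkn⟩
    rw [Nat.card_prod, natCard_sum_eq, Nat.multichoose_eq]
    have h1 : Nat.card (FaceOfCodim n k) = (n + 1).choose (n + 1 - k) := by
      rw [Nat.card_eq_fintype_card, Fintype.card_finset_len, Fintype.card_fin]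
    rw [h1, Nat.choose_symm (by omega), show k + (n + 1 - k) - 1 = n by omega,
      ← Nat.choose_symm (show n + 1 - k ≤ n by omega), show n - (n + 1 - k) = k - 1 by omega]
  rw [Finset.sum_congr rfl fun k _ => hterm k]
  have hsum : ∑ k : {k : ℕ // 1 ≤ k ∧ k ≤ n}, (n + 1).choose k.1 * n.choose (k.1 - 1) =
      ∑ k ∈ Finset.Icc 1 n, (n + 1).choose k * n.choose (k - 1) :=
    (Finset.sum_subtype (Finset.Icc 1 n) (by simp)
      (fun k => (n + 1).choose k * n.choose (k - 1))).symm
  have hvan : (2 * n + 1).choose n =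
      ∑ j ∈ Finset.range (n + 1), (n + 1).choose (j + 1) * n.choose j := by
    rw [show 2 * n + 1 = (n + 1) + n by omega, Nat.add_choose_eq,
      Finset.Nat.sum_antidiagonal_eq_sum_range_succ_mk, ← Finset.sum_range_reflect]
    refine Finset.sum_congr rfl fun j hj => ?_
    rw [Finset.mem_range] at hj
    simp only
    rw [show n + 1 - 1 - j = n - j by omega, ← Nat.choose_symm (show n - j ≤ n + 1 by omega),
      show n + 1 - (n - j) = j + 1 by omega, show n - (n - j) = j by omega]
  have hrange : ∑ k ∈ Finset.Icc 1 n, (n + 1).choose k * n.choose (k - 1) =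
      ∑ j ∈ Finset.range n, (n + 1).choose (j + 1) * n.choose j := by
    rw [Finset.range_eq_Ico]
    exact (Finset.sum_Ico_add' (fun k => (n + 1).choose k * n.choose (k - 1)) 0 n 1).symm
  rw [hsum, hrange, hvan, Finset.sum_range_succ]
  simp
  omega

/-! ### Dimension of the shape space and unisolvence -/

/-- The linear map `(p, l) ↦ p + q_T l` for `deg p ≤ n + 1` and `deg l ≤ 1`. -/
noncomputable def shapeMap (T : NSimplex n) :
    (restrictTotalDegree (Fin n) ℝ (n + 1) × restrictTotalDegree (Fin n) ℝ 1) →ₗ[ℝ]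
      MvPolynomial (Fin n) ℝ :=
  LinearMap.coprod (Submodule.subtype _)
    (LinearMap.mulLeft ℝ (bubblePoly T) ∘ₗ Submodule.subtype _)

lemma shapeMap_apply (T : NSimplex n)
    (x : restrictTotalDegree (Fin n) ℝ (n + 1) × restrictTotalDegree (Fin n) ℝ 1) :
    shapeMap T x = x.1.1 + bubblePoly T * x.2.1 := rfl

lemma isShapePair_of_prod
    (x : restrictTotalDegree (Fin n) ℝ (n + 1) × restrictTotalDegree (Fin n) ℝ 1) :
    IsShapePair x.1.1 x.2.1 :=
  ⟨(mem_restrictTotalDegree _ _ _).1 x.1.2, (mem_restrictTotalDegree _ _ _).1 x.2.2⟩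

lemma shapeSpace_eq_map_range (T : NSimplex n) :
    shapeSpace T = (LinearMap.range (shapeMap T)).map (polyFun n) := by
  have hmul : ∀ l, polyFun n (bubblePoly T * l) = bubble T * polyFun n l := fun l => by
    rw [polyFun_mul, polyFun_bubblePoly]
  apply le_antisymm
  · refine sup_le ?_ ?_
    · rintro _ ⟨p, hp, rfl⟩
      exact ⟨_, ⟨(⟨p, hp⟩, 0), rfl⟩, by simp [shapeMap_apply]⟩
    · rintro _ ⟨_, ⟨l, hl, rfl⟩, rfl⟩
      exact ⟨_, ⟨(0, ⟨l, hl⟩), rfl⟩, by simp [shapeMap_apply, hmul]⟩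
  · rintro _ ⟨_, ⟨x, rfl⟩, rfl⟩
    rw [shapeMap_apply, map_add, hmul]
    exact Submodule.add_mem_sup (Submodule.mem_map_of_mem x.1.2)
      (Submodule.mem_map_of_mem (Submodule.mem_map_of_mem x.2.2))

lemma faceAveragesVanish_zero (T : NSimplex n) : FaceAveragesVanish T 0 := by
  intro m σ _ L _
  simp

/-- The sum 𝒫_{n+1} + q_T 𝒫_1 overlaps exactly in the multiples of q_T. If p + q_T l = 0, all
averages and vertex values vanish trivially, so the unisolvence argument already shows that l is
constant. -/
lemma finrank_ker_shapeMap (T : NSimplex (N + 1)) :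
    Module.finrank ℝ (LinearMap.ker (shapeMap T)) = 1 := by
  let z : restrictTotalDegree (Fin (N + 1)) ℝ (N + 1 + 1) × restrictTotalDegree (Fin (N + 1)) ℝ 1 :=
    (⟨-bubblePoly T, by
      rw [mem_restrictTotalDegree, totalDegree_neg]; exact totalDegree_bubblePoly_le T⟩,
      ⟨1, by rw [mem_restrictTotalDegree, totalDegree_one]; omega⟩)
  have hker : LinearMap.ker (shapeMap T) = Submodule.span ℝ {z} := by
    ext x
    rw [LinearMap.mem_ker, Submodule.mem_span_singleton, shapeMap_apply]
    constructor
    · intro hx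
      have h := isShapePair_of_prod x
      obtain ⟨c, hc⟩ := affineFactor_eq_C h (T := T) (hx ▸ faceAveragesVanish_zero T)
        (fun i => by rw [hx]; simp)
      refine ⟨c, Prod.ext (Subtype.ext ?_) (Subtype.ext ?_)⟩
      · rw [hc] at hx
        have : x.1.1 = -(bubblePoly T * C c) := eq_neg_of_add_eq_zero_left hx
        rw [this]
        simp [z, smul_eq_C_mul, mul_comm]
      · rw [hc]
        simp [z, smul_eq_C_mul]
    · rintro ⟨c, rfl⟩
      simp [z]
  rw [hker, finrank_span_singleton]
  intro hz
  have := congrArg (fun x => x.2.1) hz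
  simp [z] at this

lemma finrank_shapeSpace (T : NSimplex (N + 1)) :
    Module.finrank ℝ (shapeSpace T) = (2 * (N + 1) + 1).choose (N + 1) + (N + 1) := by
  rw [shapeSpace_eq_map_range,
    ← (Submodule.equivMapOfInjective (polyFun (N + 1)) (polyFun_injective _) _).finrank_eq]
  have h := LinearMap.finrank_range_add_finrank_ker (shapeMap T)
  rw [finrank_ker_shapeMap, Module.finrank_prod, finrank_restrictTotalDegree,
    finrank_restrictTotalDegree, Nat.choose_succ_self_right,
    show N + 1 + (N + 1 + 1) = 2 * (N + 1) + 1 by omega] at h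
  omega

lemma mem_shapeSpace_iff (T : NSimplex n) (u : EuclideanSpace ℝ (Fin n) → ℝ) :
    u ∈ shapeSpace T ↔ ∃ p l, IsShapePair p l ∧ polyFun n (p + bubblePoly T * l) = u := by
  rw [shapeSpace_eq_map_range]
  constructor
  · rintro ⟨_, ⟨x, rfl⟩, rfl⟩
    exact ⟨_, _, isShapePair_of_prod x, rfl⟩
  · rintro ⟨p, l, h, rfl⟩
    exact ⟨_, ⟨(⟨p, (mem_restrictTotalDegree _ _ _).2 h.left⟩,
      ⟨l, (mem_restrictTotalDegree _ _ _).2 h.right⟩), rfl⟩, rfl⟩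

/-- Every degree of freedom is a linear functional on polynomials. -/
lemma exists_linearMap_eq_dof (T : NSimplex n)
    (ν : (k : ℕ) → FaceOfCodim n k → Fin k → EuclideanSpace ℝ (Fin n)) (i : DOFIndex n) :
    ∃ Φ : MvPolynomial (Fin n) ℝ →ₗ[ℝ] ℝ, ∀ p, dof T ν i (polyFun n p) = Φ p := by
  rcases i with ⟨⟨k, hk1, hkn⟩, F, α⟩ | i
  · obtain ⟨m, σ, hσ, hm, rfl⟩ := exists_eq_imageFace hkn F
    let D : MvPolynomial (Fin n) ℝ →ₗ[ℝ] MvPolynomial (Fin n) ℝ :=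
      { toFun := derivList (expandDirections (ν k (imageFace σ hσ hm)) α.1)
        map_add' := derivList_add _
        map_smul' := derivList_smul _ }
    refine ⟨(volume.real (cornerSimplex m))⁻¹ • (simplexIntegral (T.points ∘ σ) ∘ₗ D), fun p => ?_⟩
    simp only [dof]
    rw [iterDirDeriv_polyFun, faceAverage_imageFace]
    rfl
  · exact ⟨LinearMap.proj (T.points i) ∘ₗ polyFun n, fun p => rfl⟩

lemma isLinearMap_dof (T : NSimplex n)
    (ν : (k : ℕ) → FaceOfCodim n k → Fin k → EuclideanSpace ℝ (Fin n)) (i : DOFIndex n) :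
    IsLinearMap ℝ fun u : shapeSpace T => dof T ν i (u : EuclideanSpace ℝ (Fin n) → ℝ) := by
  obtain ⟨Φ, hΦ⟩ := exists_linearMap_eq_dof T ν i
  constructor
  · rintro ⟨u, hu⟩ ⟨w, hw⟩
    obtain ⟨p, l, _, rfl⟩ := (mem_shapeSpace_iff T u).1 hu
    obtain ⟨p', l', _, rfl⟩ := (mem_shapeSpace_iff T w).1 hw
    simp only [Submodule.coe_add]
    rw [← map_add (polyFun n), hΦ, hΦ, hΦ, map_add Φ]
  · rintro c ⟨u, hu⟩
    obtain ⟨p, l, _, rfl⟩ := (mem_shapeSpace_iff T u).1 hu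
    simp only [Submodule.coe_smul]
    rw [← map_smul (polyFun n), hΦ, hΦ, map_smul Φ]

lemma eq_zero_of_dof_eq_zero {T : NSimplex (N + 1)}
    {ν : (k : ℕ) → FaceOfCodim (N + 1) k → Fin k → EuclideanSpace ℝ (Fin (N + 1))}
    (hν : IsNormalFrame T ν) {u : EuclideanSpace ℝ (Fin (N + 1)) → ℝ} (hu : u ∈ shapeSpace T)
    (h : ∀ i, dof T ν i u = 0) : u = 0 := by
  obtain ⟨p, l, hpl, rfl⟩ := (mem_shapeSpace_iff T u).1 hu
  rw [shapePair_eq_zero hpl (faceAveragesVanish_of_dof hν h) fun i => h (Sum.inr i), map_zero]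

/-- Evaluation at all degrees of freedom is an injective linear map between spaces of equal finite
dimension, hence bijective. -/
lemma unisolvent_dof {T : NSimplex (N + 1)}
    {ν : (k : ℕ) → FaceOfCodim (N + 1) k → Fin k → EuclideanSpace ℝ (Fin (N + 1))}
    (hν : IsNormalFrame T ν) : Unisolvent (shapeSpace T) (dof T ν) := by
  refine ⟨isLinearMap_dof T ν, ?_⟩
  have hfin : Finite (DOFIndex (N + 1)) := by
    refine Nat.finite_of_card_ne_zero ?_
    rw [natCard_DOFIndex]
    omega
  have := Fintype.ofFinite (DOFIndex (N + 1))
  have hfd : FiniteDimensional ℝ (shapeSpace T) := by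
    refine FiniteDimensional.of_finrank_pos ?_
    rw [finrank_shapeSpace]
    omega
  let Φ : shapeSpace T →ₗ[ℝ] (DOFIndex (N + 1) → ℝ) :=
    LinearMap.pi fun i => (isLinearMap_dof T ν i).mk'
  have hinj : Function.Injective Φ := by
    rw [injective_iff_map_eq_zero]
    intro u hu
    exact Subtype.ext (eq_zero_of_dof_eq_zero hν u.2 fun i => congrFun hu i)
  have hsurj : Function.Surjective Φ := by
    refine (LinearMap.injective_iff_surjective_of_finrank_eq_finrank ?_).1 hinj
    rw [finrank_shapeSpace, Module.finrank_fintype_fun_eq_card, ← Nat.card_eq_fintype_card,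
      natCard_DOFIndex]
  intro c
  obtain ⟨u, hu⟩ := hsurj c
  exact ⟨u, fun i => congrFun hu i, fun w hw => hinj ((funext hw : Φ w = c).trans hu.symm)⟩

end NonconformingFE

theorem theorem2p1 (n : ℕ) (hn : 1 ≤ n) (T : NonconformingFE.NSimplex n)
    (ν : (k : ℕ) → NonconformingFE.FaceOfCodim n k → Fin k → EuclideanSpace ℝ (Fin n))
    (hν : NonconformingFE.IsNormalFrame T ν) :
    Module.finrank ℝ (NonconformingFE.shapeSpace T) = (2 * n + 1).choose n + n ∧
    Nat.card (NonconformingFE.DOFIndex n) = (2 * n + 1).choose n + n ∧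
    NonconformingFE.Unisolvent (NonconformingFE.shapeSpace T) (NonconformingFE.dof T ν) := by
  obtain ⟨N, rfl⟩ := Nat.exists_eq_add_of_le' hn
  exact ⟨NonconformingFE.finrank_shapeSpace T, NonconformingFE.natCard_DOFIndex _,
    NonconformingFE.unisolvent_dof hν⟩
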